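/- Let $T$ be a complex torus with character lattice $\Lambda=X^*(T)$, and let $\Phi\subset\Lambda$ be the root system of a reductive complex Lie group with maximal torus $T$ (any Cartan type; equivalently, $(\Lambda,\Phi,\Lambda^\vee,\Phi^\vee)$ is a reduced root datum). Fix simple roots $\alpha_1,\dots,\alpha_\ell$, with positive roots $\Phi^+$. Let $W$ be the Weyl group, $r_\alpha\in W$ the reflection in $\alpha\in\Phi$, $s_i=r_{\alpha_i}$, and $\leqslant$ the Bruhat order on $W$. Let $q$ be an indeterminate and $\mathcal{O}_q(T)=\mathbb{Z}[q,q^{-1}]\otimes\mathcal{O}(T)$, where $\mathcal{O}(T)$ is the ring of regular functions on $T$, spanned over $\mathbb{C}$ by the characters $\boldsymbol{y}\mapsto\boldsymbol{y}^\lambda$ with $\lambda\in\Lambda$. There is exactly one family $(r_{u,v})_{u,v\in W}$ of elements of the field of fractions of $\mathcal{O}_q(T)$ such that $r_{u,v}=0$ unless $u\leqslant v$, such that $r_{v,v}=1$ for all $v$, and such that for all $u,v\in W$ and every simple reflection $s=s_i$ with $sv<v$, writing $\beta=-v^{-1}(\alpha_i)$ (a positive root), $$ r_{u,v}=\begin{cases}\dfrac{1-q}{1-\boldsymbol{y}^{\beta}}\,r_{u,sv}+r_{su,sv}&\text{if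 } su<u,\\[2ex](1-q)\dfrac{\boldsymbol{y}^{\beta}}{1-\boldsymbol{y}^{\beta}}\,r_{u,sv}+q\,r_{su,sv}&\text{if } su>u.\end{cases} $$ For $u,v\in W$ let $S(u,v)=\{\alpha\in\Phi^+ : u\leqslant v r_\alpha<v\}$. Then for all $u,v\in W$ the function $$ \prod_{\beta\in S(u,v)}(1-\boldsymbol{y}^\beta)\cdot r_{u,v}(\boldsymbol{y}) $$ is regular on $T$, that is, it lies in $\mathcal{O}_q(T)$. -/

import Mathlib

noncomputable section

namespace BumpNakasuji

open scoped LaurentPolynomial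

/-- The ring `O_q(T) = ℤ[q, q⁻¹] ⊗ O(T)` for the complex torus `T` with group of rational
characters `X`. Since `O(T)` is the group algebra `ℂ[X]`, this is the group algebra of `X` over the
Laurent polynomial ring `ℂ[q, q⁻¹]`. -/
abbrev TorusRing (X : Type*) [AddCommGroup X] : Type _ := AddMonoidAlgebra ℂ[T;T⁻¹] X

instance torusRing_isDomain (X : Type*) [AddCommGroup X] [Module.Free ℤ X] :
    IsDomain (TorusRing X) := by
  have : TwoUniqueSums X :=
    TwoUniqueSums.of_injective_addHom
      (⟨(Module.Free.chooseBasis ℤ X).repr, map_add _⟩ :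
        X →ₙ+ (Module.Free.ChooseBasisIndex ℤ X →₀ ℤ))
      (Module.Free.chooseBasis ℤ X).repr.injective inferInstance
  have : NoZeroDivisors (TorusRing X) := inferInstance
  exact NoZeroDivisors.to_isDomain _

/-- The field of fractions of `O_q(T)`. -/
abbrev TorusField (X : Type*) [AddCommGroup X] : Type _ := FractionRing (TorusRing X)

/-- The indeterminate `q`, as an element of the field of fractions of `O_q(T)`. -/
def q (X : Type*) [AddCommGroup X] : TorusField X :=
  algebraMap (TorusRing X) (TorusField X) (AddMonoidAlgebra.single 0 (LaurentPolynomial.T 1))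

/-- The character `y ↦ y ^ χ` of `T`, as an element of the field of fractions of `O_q(T)`. -/
def mon {X : Type*} [AddCommGroup X] (χ : X) : TorusField X :=
  algebraMap (TorusRing X) (TorusField X) (AddMonoidAlgebra.single χ 1)

section Weyl

variable {ι X Y : Type*} [AddCommGroup X] [AddCommGroup Y] {P : RootDatum ι X Y}

/-- The reflection `r_α` in the root `α`, as an element of the Weyl group. -/
abbrev refl (P : RootDatum ι X Y) (α : ι) : P.weylGroup := RootPairing.weylGroup.ofIdx P α

/-- The length of `w`: the least number of factors in an expression of `w` as a product of
simple reflections. -/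
def length (b : P.Base) (w : P.weylGroup) : ℕ :=
  sInf {n | ∃ l : List b.support, l.length = n ∧ (l.map fun i => refl P i).prod = w}

/-- The Bruhat order `u ≤ v` on the Weyl group: the reflexive and transitive closure of the relation
`x < x r_α` whenever `r_α` is a reflection with `ℓ(x) < ℓ(x r_α)`. -/
def BruhatLE (b : P.Base) (u v : P.weylGroup) : Prop :=
  Relation.ReflTransGen
    (fun x y : P.weylGroup => ∃ α : ι, y = x * refl P α ∧ length b x < length b y) u v

/-- The strict Bruhat order. -/
def BruhatLT (b : P.Base) (u v : P.weylGroup) : Prop := BruhatLE b u v ∧ u ≠ v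

open scoped Classical in
/-- The set `S(u, v)` of positive roots `α` such that `u ≤ v r_α < v`. -/
def denomRoots [Fintype ι] (b : P.Base) (u v : P.weylGroup) : Finset ι :=
  Finset.univ.filter fun α =>
    b.IsPos α ∧ BruhatLE b u (v * refl P α) ∧ BruhatLT b (v * refl P α) v

/-- `IsRFamily b r` says that `r u v = r_{u,v}(y)` satisfies the conditions that define the
deformed Kazhdan-Lusztig `R`-polynomials of Bump and Nakasuji. In the two recursions, the root
`β = -v⁻¹(α_i)` is positive because `s_i v < v`. -/
structure IsRFamily [Module.Free ℤ X] (b : P.Base)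
    (r : P.weylGroup → P.weylGroup → TorusField X) : Prop where
  eq_zero : ∀ u v, ¬ BruhatLE b u v → r u v = 0
  eq_one : ∀ v, r v v = 1
  rec_descent : ∀ i ∈ b.support, ∀ u v : P.weylGroup, ∀ β : X,
    BruhatLT b (refl P i * v) v → β = -(v⁻¹ • P.root i) → BruhatLT b (refl P i * u) u →
    r u v = (1 - q X) / (1 - mon β) * r u (refl P i * v) + r (refl P i * u) (refl P i * v)
  rec_ascent : ∀ i ∈ b.support, ∀ u v : P.weylGroup, ∀ β : X,
    BruhatLT b (refl P i * v) v → β = -(v⁻¹ • P.root i) → BruhatLT b u (refl P i * u) →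
    r u v = (1 - q X) * (mon β / (1 - mon β)) * r u (refl P i * v)
      + q X * r (refl P i * u) (refl P i * v)

end Weyl

end BumpNakasuji

end

noncomputable section

namespace BumpNakasuji

/-! ### Weyl group, words and inversions -/

section WeylCombinatorics

variable {ι X Y : Type*} [AddCommGroup X] [AddCommGroup Y] {P : RootDatum ι X Y}

/-! The family is built inside the Iwahori-Hecke algebra with relation `(T - 1)(T + q) = 0`. Put
`c(β) = (1 - q) y^β / (1 - y^β)`. For a reduced word of `v`, multiply the factors `T_i + c(β)`,
where `β` is the inversion of `v` attached to the letter; then `r_{u,v}` is the coefficient of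
`T_u`. The two recursions are left multiplication by one more factor, and they determine the family.

The main point is that the product does not depend on the reduced word. Instead of a rank two check
of braid relations, the proof compares poles. The poles are at most simple and lie along `y^γ = 1`
for inversions `γ` of `v`. The residue along `γ` is, up to a common factor, the vector of the word
without the letter of `γ`, whose product is `v r_γ` (`IsReducedWord.exists_residue`): the roots of
the earlier letters are moved by `r_γ`, which is invisible where `y^γ = 1`. That word need not be
reduced, so the induction runs over all words, with vectors divided by `∏ φ(β)`; this makes `T_i +
c(β)` and `T_i + c(-β)` mutually inverse. By induction the residues for two reduced words agree, so
the difference is regular on `T`. It vanishes at one end of `T`, where both products tend to `T_v`,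
and is bounded at the other; hence it is zero (`IsReducedWord.wordVec_eq_of_forall`,
`normVec_eq_of_wprod_eq`).

The denominators come from the same residue. The vector of a word with product `w` is supported on
`u ≤ w`, so `r_{u,v}` has no pole along `γ` unless `u ≤ v r_γ`. This leaves exactly the factors in
`S(u,v)`. -/

lemma root_smul (w : P.weylGroup) (i : ι) : P.root (w • i) = w • P.root i :=
  RootPairing.Equiv.root_indexEquiv_eq_smul P i w.1

lemma refl_smul (i j : ι) : refl P i • j = P.reflectionPerm i j := rfl

lemma refl_smul_apply (i : ι) (x : X) : refl P i • x = P.reflection i x := rfl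

lemma weylGroup_ext {v w : P.weylGroup} (h : ∀ x : X, v • x = w • x) : v = w := by
  apply Subtype.ext
  apply RootPairing.Equiv.weightHom_injective P
  apply LinearEquiv.ext
  exact h

@[simp] lemma refl_mul_self (i : ι) : refl P i * refl P i = 1 := by
  refine weylGroup_ext fun x => ?_
  rw [mul_smul, refl_smul_apply, refl_smul_apply, one_smul]
  simp

@[simp] lemma refl_mul_refl_mul (i : ι) (w : P.weylGroup) : refl P i * (refl P i * w) = w := by
  rw [← mul_assoc, refl_mul_self, one_mul]

@[simp] lemma refl_smul_refl_smul (i j : ι) : refl P i • refl P i • j = j := by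
  rw [← mul_smul, refl_mul_self, one_smul]

@[simp] lemma refl_inv (i : ι) : (refl P i)⁻¹ = refl P i :=
  inv_eq_of_mul_eq_one_left (refl_mul_self i)

lemma refl_refl_smul (i j : ι) : refl P (refl P i • j) = refl P i * refl P j * refl P i := by
  refine weylGroup_ext fun x => ?_
  rw [mul_smul, mul_smul]
  simp only [refl_smul_apply, refl_smul, RootPairing.reflection_reflectionPerm]
  rfl

lemma refl_weyl_smul (w : P.weylGroup) (i : ι) : refl P (w • i) = w * refl P i * w⁻¹ := by
  obtain ⟨g, hg⟩ := w
  induction hg using RootPairing.weylGroup.induction generalizing i with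
  | mem j =>
    change refl P (refl P j • i) = refl P j * refl P i * (refl P j)⁻¹
    rw [refl_refl_smul, refl_inv]
  | one =>
    change refl P ((1 : P.weylGroup) • i) = 1 * refl P i * 1⁻¹
    simp
  | mul x y hx hy ihx ihy =>
    rw [← Submonoid.mk_mul_mk _ x y hx hy] at *
    have h : ∀ a b : P.weylGroup, (∀ i, refl P (a • i) = a * refl P i * a⁻¹) →
        (∀ i, refl P (b • i) = b * refl P i * b⁻¹) →
        refl P ((a * b) • i) = (a * b) * refl P i * (a * b)⁻¹ := by
      intro a b ha hb
      rw [mul_smul, ha, hb]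
      group
    exact h ⟨x, hx⟩ ⟨y, hy⟩ ihx ihy

lemma mul_refl (w : P.weylGroup) (i : ι) : w * refl P i = refl P (w • i) * w := by
  rw [refl_weyl_smul]; group

lemma refl_mul (w : P.weylGroup) (i : ι) : refl P i * w = w * refl P (w⁻¹ • i) := by
  rw [mul_refl, smul_inv_smul]

lemma root_refl_smul_self (i : ι) : P.root (refl P i • i) = -P.root i := by
  rw [refl_smul, RootPairing.root_reflectionPerm, RootPairing.reflection_apply_self]

lemma root_smul_refl_smul_self (w : P.weylGroup) (i : ι) :
    P.root (w • refl P i • i) = -P.root (w • i) := by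
  rw [root_smul, root_refl_smul_self, smul_neg, root_smul]

lemma refl_eq_of_root_eq_neg {i j : ι} (h : P.root i = -P.root j) : refl P i = refl P j := by
  have : i = refl P j • j := P.root.injective (by rw [h, root_refl_smul_self])
  rw [this, refl_refl_smul, mul_assoc, refl_mul_self, mul_one]

/-- The product in the Weyl group of a word in the simple reflections. -/
def wprod {b : P.Base} (l : List b.support) : P.weylGroup := (l.map fun i => refl P i).prod

variable {b : P.Base}

@[simp] lemma wprod_nil : wprod ([] : List b.support) = 1 := rfl

@[simp] lemma wprod_cons (i : b.support) (l : List b.support) :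
    wprod (i :: l) = refl P i * wprod l := by
  simp [wprod]

lemma wprod_append (l l' : List b.support) : wprod (l ++ l') = wprod l * wprod l' := by
  simp [wprod]

lemma isPos_iff_not_of_root_eq_neg {i j : ι} (h : P.root i = -P.root j) :
    b.IsPos i ↔ ¬ b.IsPos j := by
  let := P.indexNeg
  have : i = -j := P.root.injective (by rw [h]; simp)
  rw [this]
  exact RootPairing.Base.IsPos.neg_iff_not b j

lemma isPos_smul_refl_smul_self (w : P.weylGroup) (i : ι) :
    b.IsPos (w • refl P i • i) ↔ ¬ b.IsPos (w • i) :=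
  isPos_iff_not_of_root_eq_neg (root_smul_refl_smul_self w i)

lemma isPos_refl_smul_self (i : ι) : b.IsPos (refl P i • i) ↔ ¬ b.IsPos i :=
  isPos_iff_not_of_root_eq_neg (root_refl_smul_self i)

lemma length_wprod_le (l : List b.support) : length b (wprod l) ≤ l.length :=
  Nat.sInf_le ⟨l, rfl, rfl⟩

variable [Fintype ι] [P.IsReduced]

lemma isPos_refl_smul {i j : ι} (hj : b.IsPos j) (hi : i ∈ b.support) (hji : j ≠ i) :
    b.IsPos (refl P i • j) :=
  RootPairing.Base.IsPos.reflectionPerm hj hi hji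

lemma exists_wprod_eq (w : P.weylGroup) : ∃ l : List b.support, wprod l = w := by
  have key (i : ι) : ∃ l : List b.support, wprod l = refl P i := by
    refine b.induction_reflect i (p := fun i => ∃ l : List b.support, wprod l = refl P i) ?_ ?_ ?_
    · rintro i ⟨l, hl⟩
      refine ⟨l, ?_⟩
      rw [hl, ← refl_smul]
      exact (refl_eq_of_root_eq_neg (root_refl_smul_self i)).symm
    · intro i hi
      exact ⟨[⟨i, hi⟩], by simp⟩
    · rintro i j ⟨l, hl⟩ hj
      refine ⟨⟨j, hj⟩ :: l ++ [⟨j, hj⟩], ?_⟩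
      rw [wprod_append, wprod_cons, hl, ← refl_smul, refl_refl_smul]
      simp
  obtain ⟨g, hg⟩ := w
  induction hg using RootPairing.weylGroup.induction with
  | mem i => exact key i
  | one => exact ⟨[], rfl⟩
  | mul x y hx hy ihx ihy =>
    obtain ⟨l, hl⟩ := ihx
    obtain ⟨l', hl'⟩ := ihy
    exact ⟨l ++ l', by rw [wprod_append, hl, hl']; rfl⟩

/-- A word is reduced if it has minimal length among the words with the same product. -/
def IsReducedWord (l : List b.support) : Prop := l.length = length b (wprod l)

lemma exists_isReducedWord (b : P.Base) (w : P.weylGroup) :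
    ∃ l : List b.support, IsReducedWord l ∧ wprod l = w := by
  -- Nonemptiness matters: the infimum of the empty set would be `0` by convention.
  have : {n | ∃ l : List b.support, l.length = n ∧ (l.map fun i => refl P i).prod = w}.Nonempty := by
    obtain ⟨l, hl⟩ := exists_wprod_eq (b := b) w
    exact ⟨_, l, rfl, hl⟩
  obtain ⟨l, h1, h2⟩ := Nat.sInf_mem this
  refine ⟨l, ?_, h2⟩
  rw [IsReducedWord, wprod, h2]
  exact h1

/-- The strong exchange property. -/
lemma exists_wprod_eq_refl_mul (l : List b.support) (α : ι) (hα : b.IsPos α)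
    (h : ¬ b.IsPos ((wprod l)⁻¹ • α)) :
    ∃ l' : List b.support, l'.length + 1 = l.length ∧ wprod l' = refl P α * wprod l := by
  induction l generalizing α with
  | nil => simp [hα] at h
  -- If `α` is the root of the first letter, that letter is deleted. Otherwise `s_j α` is still
  -- positive and the deletion happens in the tail.
  | cons j l ih =>
    by_cases hj : α = j
    · exact ⟨l, rfl, by rw [hj, wprod_cons, refl_mul_refl_mul]⟩
    · obtain ⟨l', h1, h2⟩ := ih (refl P j • α) (isPos_refl_smul hα j.2 hj) (by
        rwa [wprod_cons, mul_inv_rev, refl_inv, mul_smul] at h)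
      refine ⟨j :: l', by simp [h1], ?_⟩
      rw [wprod_cons, wprod_cons, h2, refl_refl_smul]
      simp only [mul_assoc, refl_mul_refl_mul]

lemma length_refl_mul_lt {α : ι} (hα : b.IsPos α) {w : P.weylGroup} (h : ¬ b.IsPos (w⁻¹ • α)) :
    length b (refl P α * w) < length b w := by
  obtain ⟨l, hl, rfl⟩ := exists_isReducedWord b w
  obtain ⟨l', h1, h2⟩ := exists_wprod_eq_refl_mul l α hα h
  have := length_wprod_le l'
  rw [IsReducedWord] at hl
  rw [← h2]
  omega

lemma lt_length_refl_mul {α : ι} (hα : b.IsPos α) {w : P.weylGroup} (h : b.IsPos (w⁻¹ • α)) :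
    length b w < length b (refl P α * w) := by
  have := length_refl_mul_lt hα (w := refl P α * w) (by
    rw [mul_inv_rev, refl_inv, mul_smul, isPos_smul_refl_smul_self]
    exact not_not_intro h)
  rwa [refl_mul_refl_mul] at this

/-- Right multiplication by `r_β` is left multiplication by the reflection in the positive root
`-wβ`. -/
lemma length_mul_refl_lt {β : ι} (hβ : b.IsPos β) {w : P.weylGroup} (h : ¬ b.IsPos (w • β)) :
    length b (w * refl P β) < length b w := by
  have := length_refl_mul_lt (b := b) (α := w • refl P β • β) (w := w)
    ((isPos_smul_refl_smul_self w β).2 h) (by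
      rw [inv_smul_smul, isPos_refl_smul_self]; exact not_not_intro hβ)
  rwa [← mul_refl, refl_eq_of_root_eq_neg (root_refl_smul_self β)] at this

lemma lt_length_mul_refl {β : ι} (hβ : b.IsPos β) {w : P.weylGroup} (h : b.IsPos (w • β)) :
    length b w < length b (w * refl P β) := by
  have := lt_length_refl_mul (b := b) (α := w • β) (w := w) h (by rwa [inv_smul_smul])
  rwa [← mul_refl] at this

lemma length_refl_mul_le {i : ι} (hi : i ∈ b.support) (w : P.weylGroup) :
    length b (refl P i * w) ≤ length b w + 1 := by
  obtain ⟨l, hl, rfl⟩ := exists_isReducedWord b w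
  have := length_wprod_le (⟨i, hi⟩ :: l)
  rw [IsReducedWord] at hl
  simpa [hl] using this

omit [Fintype ι] [P.IsReduced] in
lemma length_one : length b (1 : P.weylGroup) = 0 :=
  Nat.le_zero.1 (length_wprod_le (b := b) [])

lemma eq_one_of_length_eq_zero {w : P.weylGroup} (h : length b w = 0) : w = 1 := by
  obtain ⟨l, hl, rfl⟩ := exists_isReducedWord b w
  rw [IsReducedWord, h, List.length_eq_zero_iff] at hl
  simp [hl]

omit [Fintype ι] [P.IsReduced] in
lemma isPos_of_mem_support (i : b.support) : b.IsPos i :=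
  RootPairing.Base.isPos_of_mem_support i.2

lemma IsReducedWord.tail {i : b.support} {l : List b.support} (h : IsReducedWord (i :: l)) :
    IsReducedWord l := by
  have h1 := length_refl_mul_le i.2 (wprod l)
  have h2 := length_wprod_le l
  rw [IsReducedWord, wprod_cons, List.length_cons] at h
  rw [IsReducedWord]
  omega

lemma IsReducedWord.isPos {i : b.support} {l : List b.support} (h : IsReducedWord (i :: l)) :
    b.IsPos ((wprod l)⁻¹ • (i : ι)) := by
  by_contra hc
  have h1 := length_refl_mul_lt (isPos_of_mem_support i) hc
  have h2 := length_wprod_le l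
  rw [IsReducedWord, wprod_cons, List.length_cons] at h
  omega

lemma IsReducedWord.cons {i : b.support} {l : List b.support} (h : IsReducedWord l)
    (hi : b.IsPos ((wprod l)⁻¹ • (i : ι))) : IsReducedWord (i :: l) := by
  have h1 := lt_length_refl_mul (isPos_of_mem_support i) hi
  have h2 := length_refl_mul_le i.2 (wprod l)
  rw [IsReducedWord] at h ⊢
  rw [wprod_cons, List.length_cons]
  omega

/-- The roots `(w' w)⁻¹ α_i`, where `w'` runs through the products of the proper suffixes of a word
and `i` is the letter preceding the suffix. -/
def rootsFrom {b : P.Base} : List b.support → P.weylGroup → List ι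
  | [], _ => []
  | i :: l, w => (wprod l * w)⁻¹ • (i : ι) :: rootsFrom l w

/-- The list of the roots attached to the letters of a word. -/
def rootsOf {b : P.Base} : List b.support → List ι
  | [] => []
  | i :: l => (wprod l)⁻¹ • (i : ι) :: rootsOf l

omit [Fintype ι] [P.IsReduced] in
lemma rootsOf_append (l l' : List b.support) :
    rootsOf (l ++ l') = rootsFrom l (wprod l') ++ rootsOf l' := by
  induction l with
  | nil => rfl
  | cons i l ih => simp [rootsOf, rootsFrom, ih, wprod_append]

open scoped Classical in
/-- The set of inversions of `w`: the positive roots made negative by `w`. -/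
def inversions (b : P.Base) (w : P.weylGroup) : Finset ι :=
  Finset.univ.filter fun β => b.IsPos β ∧ ¬ b.IsPos (w • β)

omit [P.IsReduced] in
lemma mem_inversions {w : P.weylGroup} {β : ι} :
    β ∈ inversions b w ↔ b.IsPos β ∧ ¬ b.IsPos (w • β) := by
  simp [inversions]

/-- A simple reflection permutes the positive roots other than its own, so the sign of `wβ` changes
only if `wβ = ±α_i`; the minus sign would make `β` negative. -/
lemma mem_inversions_refl_mul {w : P.weylGroup} {i : ι} (hi : i ∈ b.support)
    (h : b.IsPos (w⁻¹ • i)) (β : ι) :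
    β ∈ inversions b (refl P i * w) ↔ β = w⁻¹ • i ∨ β ∈ inversions b w := by
  have hip : b.IsPos i := RootPairing.Base.isPos_of_mem_support hi
  simp only [mem_inversions, mul_smul]
  by_cases h1 : β = w⁻¹ • i
  · simp only [h1, smul_inv_smul, h, isPos_refl_smul_self, hip, true_and, not_true, not_false_iff,
      true_or]
  · simp only [h1, false_or]
    refine and_congr_right fun hβ => not_congr ?_
    by_cases h2 : b.IsPos (w • β)
    · exact iff_of_true (isPos_refl_smul h2 hi fun h3 => h1 (by rw [← h3, inv_smul_smul])) h2
    · refine iff_of_false (fun h3 => ?_) h2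
      by_cases h4 : refl P i • w • β = i
      · have : w • β = refl P i • i := by
          rw [← refl_smul_refl_smul (P := P) i (w • β), h4]
        have h5 : β = w⁻¹ • refl P i • i := by rw [← this, inv_smul_smul]
        rw [h5, isPos_smul_refl_smul_self] at hβ
        exact hβ h
      · have := isPos_refl_smul h3 hi h4
        rw [← mul_smul, refl_mul_self, one_smul] at this
        exact h2 this

lemma IsReducedWord.nodup_and_mem {l : List b.support} (h : IsReducedWord l) :
    (rootsOf l).Nodup ∧ ∀ β, β ∈ rootsOf l ↔ β ∈ inversions b (wprod l) := by
  induction l with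
  | nil => simp [rootsOf, mem_inversions]
  | cons i l ih =>
    obtain ⟨h1, h2⟩ := ih h.tail
    constructor
    · refine List.nodup_cons.2 ⟨fun h3 => ?_, h1⟩
      rw [h2, mem_inversions, smul_inv_smul] at h3
      exact h3.2 (isPos_of_mem_support i)
    · intro β
      rw [wprod_cons, mem_inversions_refl_mul i.2 h.isPos, ← h2, rootsOf, List.mem_cons]

lemma IsReducedWord.prod_rootsOf {l : List b.support} (h : IsReducedWord l) {K : Type*}
    [CommMonoid K] (f : ι → K) :
    ((rootsOf l).map f).prod = ∏ β ∈ inversions b (wprod l), f β := by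
  classical
  obtain ⟨h1, h2⟩ := h.nodup_and_mem
  rw [← List.prod_toFinset f h1]
  congr 1
  ext β
  rw [List.mem_toFinset, h2]

omit [Fintype ι] [P.IsReduced] in
/-- The deletion property: omitting the letter with root `γ` from a word multiplies the product by
the reflection in `γ`. -/
lemma wprod_append_eq_mul_refl (l l' : List b.support) (j : b.support) :
    wprod (l ++ l') = wprod (l ++ j :: l') * refl P ((wprod l')⁻¹ • (j : ι)) := by
  rw [wprod_append, wprod_append, wprod_cons, refl_weyl_smul]
  simp only [mul_assoc, inv_inv, mul_inv_cancel_left, refl_mul_refl_mul]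

omit [Fintype ι] [P.IsReduced] in
lemma exists_append_of_mem_rootsOf {l : List b.support} {γ : ι} (h : γ ∈ rootsOf l) :
    ∃ (l₁ l₂ : List b.support) (j : b.support),
      l = l₁ ++ j :: l₂ ∧ γ = (wprod l₂)⁻¹ • (j : ι) := by
  induction l with
  | nil => simp [rootsOf] at h
  | cons i l ih =>
    rw [rootsOf, List.mem_cons] at h
    rcases h with h | h
    · exact ⟨[], l, i, rfl, h⟩
    · obtain ⟨l₁, l₂, j, h1, h2⟩ := ih h
      exact ⟨i :: l₁, l₂, j, by rw [h1]; rfl, h2⟩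

/-- If prepending `i` to a reduced word does not give a reduced word, then the product of the word
is also the product of a word that starts with `i` and has the same length. -/
lemma exists_of_not_isReducedWord_cons {i : b.support} {l : List b.support} (h : IsReducedWord l)
    (hi : ¬ IsReducedWord (i :: l)) :
    ∃ l' : List b.support, l'.length + 1 = l.length ∧ wprod (i :: l') = wprod l := by
  have h1 : ¬ b.IsPos ((wprod l)⁻¹ • (i : ι)) := fun h2 => hi (h.cons h2)
  obtain ⟨l', h2, h3⟩ := exists_wprod_eq_refl_mul l i (isPos_of_mem_support i) h1
  exact ⟨l', h2, by rw [wprod_cons, h3, refl_mul_refl_mul]⟩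

/-! ### Bruhat order -/

section Bruhat

omit [P.IsReduced] [Fintype ι] in
lemma BruhatLE.length_le {u v : P.weylGroup} (h : BruhatLE b u v) :
    length b u ≤ length b v ∧ (length b u = length b v → u = v) := by
  induction h with
  | refl => simp
  | tail _ h2 ih =>
    obtain ⟨α, -, h3⟩ := h2
    refine ⟨by omega, by omega⟩

omit [Fintype ι] [P.IsReduced] in
lemma length_lt_of_bruhatLT {u v : P.weylGroup} (h : BruhatLT b u v) : length b u < length b v :=
  lt_of_le_of_ne h.1.length_le.1 fun h1 => h.2 (h.1.length_le.2 h1)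

omit [Fintype ι] [P.IsReduced] in
lemma bruhatLE_mul_refl {v : P.weylGroup} {α : ι} (h : length b v < length b (v * refl P α)) :
    BruhatLE b v (v * refl P α) :=
  Relation.ReflTransGen.single ⟨α, rfl, h⟩

omit [Fintype ι] [P.IsReduced] in
lemma bruhatLT_mul_refl {v : P.weylGroup} {α : ι} (h : length b (v * refl P α) < length b v) :
    BruhatLT b (v * refl P α) v := by
  refine ⟨?_, fun h1 => by rw [h1] at h; exact lt_irrefl _ h⟩
  have := bruhatLE_mul_refl (b := b) (v := v * refl P α) (α := α) (by
    rwa [mul_assoc, refl_mul_self, mul_one])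
  rwa [mul_assoc, refl_mul_self, mul_one] at this

lemma bruhatLT_refl_mul_iff {i : ι} (hi : i ∈ b.support) (v : P.weylGroup) :
    BruhatLT b (refl P i * v) v ↔ ¬ b.IsPos (v⁻¹ • i) := by
  have hip : b.IsPos i := RootPairing.Base.isPos_of_mem_support hi
  constructor
  · intro h h1
    exact lt_asymm (length_lt_of_bruhatLT h) (lt_length_refl_mul hip h1)
  · intro h
    have := length_refl_mul_lt hip h
    rw [refl_mul] at this ⊢
    exact bruhatLT_mul_refl this

lemma bruhatLT_refl_mul_iff' {i : ι} (hi : i ∈ b.support) (v : P.weylGroup) :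
    BruhatLT b v (refl P i * v) ↔ b.IsPos (v⁻¹ • i) := by
  have := bruhatLT_refl_mul_iff hi (refl P i * v)
  rw [refl_mul_refl_mul, mul_inv_rev, refl_inv, mul_smul, isPos_smul_refl_smul_self, not_not] at this
  exact this

/-- For positive `α`, the hypotheses say that `yα` is negative and `s_i yα` positive. This forces
`yα = -α_i`, so `r_α` on the right of `y` acts as `s_i` on the left. -/
lemma refl_mul_eq_mul_refl_of_length {i : ι} (hi : i ∈ b.support) {y : P.weylGroup} {α : ι}
    (h1 : length b (y * refl P α) < length b y)
    (h2 : length b (refl P i * y) < length b (refl P i * (y * refl P α))) :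
    refl P i * (y * refl P α) = y := by
  wlog hα : b.IsPos α generalizing α
  · have h3 := this (α := refl P α • α)
    rw [isPos_refl_smul_self, refl_eq_of_root_eq_neg (root_refl_smul_self α)] at h3
    exact h3 h1 h2 hα
  have h3 : ¬ b.IsPos (y • α) := fun h => lt_asymm h1 (lt_length_mul_refl hα h)
  rw [← mul_assoc] at h2
  have h4 : b.IsPos ((refl P i * y) • α) := by
    by_contra h
    exact lt_asymm h2 (length_mul_refl_lt hα h)
  rw [mul_smul] at h4
  have h5 : refl P i • y • α = i := by
    by_contra h
    have := isPos_refl_smul h4 hi h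
    rw [← mul_smul, refl_mul_self, one_smul] at this
    exact h3 this
  have h6 : y • α = refl P i • i := by
    rw [← refl_smul_refl_smul (P := P) i (y • α), h5]
  rw [mul_refl, h6, refl_eq_of_root_eq_neg (root_refl_smul_self i), refl_mul_refl_mul]

/-- A weak form of the lifting property of the Bruhat order. -/
lemma BruhatLE.refl_mul {i : ι} (hi : i ∈ b.support) {x y : P.weylGroup} (h : BruhatLE b x y) :
    BruhatLE b (refl P i * x) y ∨ BruhatLE b (refl P i * x) (refl P i * y) := by
  induction h with
  | refl => exact Or.inr Relation.ReflTransGen.refl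
  | @tail y z h1 h2 ih =>
    have h2' : BruhatLE b y z := Relation.ReflTransGen.single h2
    rcases ih with ih | ih
    · exact Or.inl (ih.trans h2')
    · obtain ⟨α, rfl, h3⟩ := h2
      rcases lt_or_ge (length b (refl P i * y)) (length b (refl P i * (y * refl P α))) with h4 | h4
      · refine Or.inr (ih.trans ?_)
        rw [← mul_assoc] at h4 ⊢
        exact bruhatLE_mul_refl h4
      · rcases h4.lt_or_eq with h4 | h4
        -- Here `s_i` reverses the covering step, which is possible only if `s_i y` is the upper
        -- element `y r_α` itself.
        · have := refl_mul_eq_mul_refl_of_length (b := b) hi (y := y * refl P α) (α := α)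
            (by simpa [mul_assoc] using h3) (by simpa [mul_assoc] using h4)
          rw [mul_assoc, refl_mul_self, mul_one] at this
          rw [this] at ih
          exact Or.inl ih
        -- Multiplication by a reflection always changes the length.
        · exfalso
          have hα : ∃ β, b.IsPos β ∧ refl P β = refl P α := by
            by_cases h : b.IsPos α
            · exact ⟨α, h, rfl⟩
            · exact ⟨refl P α • α, (isPos_refl_smul_self α).2 h,
                refl_eq_of_root_eq_neg (root_refl_smul_self α)⟩
          obtain ⟨β, hβ, hβα⟩ := hα
          rw [← hβα, ← mul_assoc] at h4
          by_cases h : b.IsPos ((refl P i * y) • β)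
          · exact (lt_length_mul_refl hβ h).ne' h4
          · exact (length_mul_refl_lt hβ h).ne h4

lemma bruhatLE_refl_mul {i : ι} (hi : i ∈ b.support) {v : P.weylGroup} (h : b.IsPos (v⁻¹ • i)) :
    BruhatLE b v (refl P i * v) := ((bruhatLT_refl_mul_iff' hi v).2 h).1

lemma bruhatLE_of_refl_mul_le {i : ι} (hi : i ∈ b.support) {u v : P.weylGroup}
    (h : BruhatLE b (refl P i * u) v) (hv : b.IsPos (v⁻¹ • i)) : BruhatLE b u (refl P i * v) := by
  rcases h.refl_mul hi with h | h
  · rw [refl_mul_refl_mul] at h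
    exact h.trans (bruhatLE_refl_mul hi hv)
  · rwa [refl_mul_refl_mul] at h

end Bruhat

/-! ### A grading that is positive on positive roots -/

section Height

omit [P.IsReduced] in
open scoped Classical in
/-- The pairing with the sum of the positive coroots. -/
def posPairing (b : P.Base) : X →+ ℤ :=
  ∑ i with b.IsPos i, (P.coroot' i).toAddMonoidHom

omit [P.IsReduced] in
open scoped Classical in
lemma posPairing_apply_root (j : ι) :
    posPairing b (P.root j) = ∑ i with b.IsPos i, P.pairing j i := by
  simp [posPairing]

/-- The reflection `s_j` permutes the other positive roots and negates the pairings of `α_j` with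
their coroots, so these cancel and only the pairing of `α_j` with its own coroot remains. -/
lemma posPairing_of_mem_support (j : b.support) : posPairing b (P.root j) = 2 := by
  classical
  rw [posPairing_apply_root, ← Finset.add_sum_erase _ _ (a := (j : ι)) (by
    simp [isPos_of_mem_support]), RootPairing.pairing_same]
  suffices ∑ x ∈ ({i | b.IsPos i} : Finset ι).erase j, P.pairing j x =
      -∑ x ∈ ({i | b.IsPos i} : Finset ι).erase j, P.pairing j x by omega
  have hmem : ∀ i ∈ ({i | b.IsPos i} : Finset ι).erase j,
      P.reflectionPerm j i ∈ ({i | b.IsPos i} : Finset ι).erase j := by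
    intro i hi
    simp only [Finset.mem_erase, Finset.mem_filter, Finset.mem_univ, true_and] at hi ⊢
    refine ⟨fun h => ?_, isPos_refl_smul hi.2 j.2 hi.1⟩
    have h1 : i = refl P (j : ι) • (j : ι) := by
      rw [← refl_smul_refl_smul (P := P) (j : ι) i, refl_smul (j : ι) i, h]
    have h2 := hi.2
    rw [h1, isPos_refl_smul_self] at h2
    exact h2 (isPos_of_mem_support j)
  rw [← Finset.sum_neg_distrib]
  refine Finset.sum_bij' (fun i _ => P.reflectionPerm j i) (fun i _ => P.reflectionPerm j i)
    hmem hmem (by simp) (by simp) ?_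
  intro i _
  rw [RootPairing.pairing_reflectionPerm, RootPairing.pairing_reflectionPerm_self_left, neg_neg]

lemma posPairing_pos {i : ι} (hi : b.IsPos i) : 0 < posPairing b (P.root i) := by
  refine hi.induction_on_add (p := fun i => 0 < posPairing b (P.root i)) ?_ ?_
  · intro i hi
    rw [posPairing_of_mem_support ⟨i, hi⟩]
    norm_num
  · intro i j k h1 h2 hj
    rw [h1, map_add, posPairing_of_mem_support ⟨j, hj⟩]
    omega

end Height

omit [Fintype ι] in
/-- Distinct positive roots are not proportional. -/
lemma zsmul_root_notMem_zmultiples {β γ : ι} (h1 : P.root β ≠ P.root γ)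
    (h2 : P.root β ≠ -P.root γ) (n : ℤ) (hn : n • P.root β ∈ AddSubgroup.zmultiples (P.root γ)) :
    n = 0 := by
  have := RootPairing.IsReduced.linearIndependent P (i := β) (j := γ)
    (fun h => h1 (by rw [h])) h2
  rw [LinearIndependent.pair_iff] at this
  obtain ⟨m, hm⟩ := AddSubgroup.mem_zmultiples_iff.1 hn
  exact (this n (-m) (by rw [neg_smul, hm]; abel)).1

end WeylCombinatorics

/-! ### Divisibility by `1 - y^γ` in group algebras -/

section GroupAlgebra

variable {k X : Type*} [CommRing k] [AddCommGroup X]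

open AddMonoidAlgebra

lemma one_sub_single_dvd_single_zsmul_sub (γ x : X) (n : ℤ) (a : k) :
    (1 - single γ 1 : k[X]) ∣ single (x + n • γ) a - single x a := by
  have h (n : ℕ) (x : X) : (1 - single γ 1 : k[X]) ∣ single (x + n • γ) a - single x a := by
    have h1 : (single (x + n • γ) a - single x a : k[X]) =
        single x a * ((single γ 1) ^ n - 1 ^ n) := by
      rw [mul_sub, single_pow, one_pow, one_pow, single_mul_single, mul_one, mul_one]
    rw [h1]
    exact Dvd.dvd.mul_left ((dvd_sub_comm.1 (sub_dvd_pow_sub_pow _ _ _))) _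
  obtain ⟨n, rfl | rfl⟩ := n.eq_nat_or_neg
  · simpa using h n x
  · have := h n (x + (-(n : ℤ)) • γ)
    rw [dvd_sub_comm]
    simpa using this

/-- An element of a group algebra whose image in the group algebra of the quotient by `γ` vanishes
is a multiple of `1 - γ`. -/
lemma one_sub_single_dvd_iff (γ : X) (f : k[X]) :
    (1 - single γ 1 : k[X]) ∣ f ↔
      mapDomainRingHom k (QuotientAddGroup.mk' (AddSubgroup.zmultiples γ)) f = 0 := by
  set π := QuotientAddGroup.mk' (AddSubgroup.zmultiples γ) with hπ
  have hγ : π γ = 0 := (QuotientAddGroup.eq_zero_iff γ).2 (AddSubgroup.mem_zmultiples γ)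
  constructor
  · rintro ⟨g, rfl⟩
    rw [map_mul, map_sub, map_one]
    have : mapDomainRingHom k π (single γ 1 : k[X]) = 1 := by
      simp [hγ, one_def]
    rw [this, sub_self, zero_mul]
  · intro h
    -- Modulo `1 - y^γ`, every element is congruent to one supported on chosen coset
    -- representatives, and that one is determined by the image in the quotient.
    have hdvd : (1 - single γ 1 : k[X]) ∣
        mapDomain Quotient.out (mapDomainRingHom k π f) - f := by
      clear h
      induction f using AddMonoidAlgebra.induction_linear with
      | zero => simp
      | add f g hf hg =>
        rw [map_add, mapDomain_add, add_sub_add_comm]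
        exact dvd_add hf hg
      | single x a =>
        have h1 : ((π x).out : X ⧸ AddSubgroup.zmultiples γ) = π x := Quotient.out_eq _
        have h2 : -x + (π x).out ∈ AddSubgroup.zmultiples γ := QuotientAddGroup.eq.1 h1.symm
        obtain ⟨n, hn⟩ := AddSubgroup.mem_zmultiples_iff.1 h2
        have h3 : (π x).out = x + n • γ := by rw [hn]; abel
        have h4 : mapDomain Quotient.out (mapDomainRingHom k π (single x a : k[X])) =
            (single (x + n • γ) a : k[X]) := by
          rw [mapDomainRingHom_apply, mapDomain_single, mapDomain_single, ← h3]
        rw [h4]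
        exact one_sub_single_dvd_single_zsmul_sub γ x n a
    rw [h, mapDomain_zero, zero_sub, dvd_neg] at hdvd
    exact hdvd

/-- In the group algebra of an abelian group `1 - a δ` is a nonzerodivisor if `δ` has infinite
order. -/
lemma eq_zero_of_one_sub_single_mul_eq_zero {δ : X} (hδ : ∀ n : ℤ, n • δ = 0 → n = 0) (a : k)
    (f : k[X]) (h : (1 - single δ a) * f = 0) : f = 0 := by
  by_contra hf
  have hx (x : X) : f.coeff (x + δ) = a * f.coeff x := by
    rw [sub_mul, one_mul, sub_eq_zero] at h
    nth_rewrite 1 [h]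
    exact coeff_single_mul_eq_mul_coeff _ fun y _ => by rw [add_comm x δ, add_right_inj]
  obtain ⟨x, hx0⟩ : ∃ x, f.coeff x ≠ 0 := by
    by_contra! hc
    exact hf (by ext x; exact hc x)
  -- The recurrence is followed backwards because `a` may be a zero divisor: a nonzero coefficient
  -- at `x` forces one at `x - δ`, and so on, against finite support.
  have hback (n : ℕ) : f.coeff (x - n • δ) ≠ 0 := by
    induction n with
    | zero => simpa using hx0
    | succ n ih =>
      intro h0
      apply ih
      have : x - n • δ = x - (n + 1) • δ + δ := by rw [add_smul, one_smul]; abel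
      rw [this, hx, h0, mul_zero]
  have hinj : Function.Injective fun n : ℕ => x - n • δ := by
    intro m n hmn
    have h1 : ((m : ℤ) - n) • δ = 0 := by
      have : m • δ = n • δ := sub_right_injective hmn
      rw [sub_smul, natCast_zsmul, natCast_zsmul, this, sub_self]
    have := hδ _ h1
    omega
  exact Set.infinite_of_injective_forall_mem hinj
    (fun n => Finsupp.mem_support_iff.2 (hback n)) (Finset.finite_toSet (Finsupp.support f.coeff))

/-- The quotient of `X` by `ℤγ` may have torsion, so `1 - y^γ` need not be prime; it suffices that
`δ` has infinite order there. The cases `a = 1` and `a = q` handle the denominators of `c`, `φ` and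
`φ⁻¹`. -/
lemma dvd_of_dvd_one_sub_single_mul {γ δ : X}
    (hδ : ∀ n : ℤ, n • δ ∈ AddSubgroup.zmultiples γ → n = 0) (a : k) (f : k[X])
    (h : (1 - single γ 1 : k[X]) ∣ (1 - single δ a) * f) : (1 - single γ 1 : k[X]) ∣ f := by
  rw [one_sub_single_dvd_iff] at h ⊢
  rw [map_mul, map_sub, map_one, mapDomainRingHom_apply, mapDomain_single] at h
  refine eq_zero_of_one_sub_single_mul_eq_zero (fun n hn => hδ n ?_) a _ h
  rw [← map_zsmul] at hn
  exact (QuotientAddGroup.eq_zero_iff _).1 hn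

end GroupAlgebra

/-! ### Order of vanishing with respect to a grading -/

section Order

variable {k X : Type*} [CommRing k] [AddCommGroup X]

open AddMonoidAlgebra

/-- The elements of a group algebra supported where `ht` is at least `n`. -/
def orderGE (k : Type*) [CommRing k] (ht : X →+ ℤ) (n : ℤ) : AddSubgroup k[X] where
  carrier := {f | ∀ x, f.coeff x ≠ 0 → n ≤ ht x}
  zero_mem' := fun x hx => (hx rfl).elim
  add_mem' := by
    intro f g hf hg x hx
    by_contra hc
    have h1 : f.coeff x = 0 := by_contra fun h => hc (hf x h)
    have h2 : g.coeff x = 0 := by_contra fun h => hc (hg x h)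
    exact hx (by rw [AddMonoidAlgebra.coeff_add, Finsupp.add_apply, h1, h2, add_zero])
  neg_mem' := by
    intro f hf x hx
    exact hf x fun h => hx (by rw [AddMonoidAlgebra.coeff_neg, Finsupp.neg_apply, h, neg_zero])

variable {ht : X →+ ℤ}

lemma mem_orderGE {n : ℤ} {f : k[X]} : f ∈ orderGE k ht n ↔ ∀ x, f.coeff x ≠ 0 → n ≤ ht x := Iff.rfl

lemma single_mem_orderGE {n : ℤ} {x : X} (h : n ≤ ht x) (a : k) :
    (single x a : k[X]) ∈ orderGE k ht n := by
  classical
  intro y hy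
  rw [coeff_single, Finsupp.single_apply] at hy
  split_ifs at hy with hxy
  · rwa [← hxy]
  · exact (hy rfl).elim

lemma one_mem_orderGE : (1 : k[X]) ∈ orderGE k ht 0 :=
  single_mem_orderGE (by simp) 1

lemma mul_mem_orderGE {m n : ℤ} {f g : k[X]} (hf : f ∈ orderGE k ht m) (hg : g ∈ orderGE k ht n) :
    f * g ∈ orderGE k ht (m + n) := by
  classical
  intro x hx
  have := AddMonoidAlgebra.support_coeff_mul_subset (x := f) (y := g) (Finsupp.mem_support_iff.2 hx)
  obtain ⟨y, hy, z, hz, rfl⟩ := Finset.mem_add.1 this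
  rw [map_add]
  exact add_le_add (hf y (Finsupp.mem_support_iff.1 hy)) (hg z (Finsupp.mem_support_iff.1 hz))

lemma orderGE_mono {m n : ℤ} (h : m ≤ n) {f : k[X]} (hf : f ∈ orderGE k ht n) :
    f ∈ orderGE k ht m := fun x hx => h.trans (hf x hx)

/-- Multiplication by an element with leading term `1` does not change the order. -/
lemma mem_orderGE_of_mul_mem {n : ℤ} {d f : k[X]} (hd : d - 1 ∈ orderGE k ht 1)
    (h : d * f ∈ orderGE k ht n) : f ∈ orderGE k ht n := by
  by_contra hc
  simp only [mem_orderGE, not_forall, not_le] at hc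
  obtain ⟨x₀, hx₀, hx₀n⟩ := hc
  obtain ⟨x, hx, hmin⟩ := Finset.exists_min_image f.coeff.support ht
    ⟨x₀, Finsupp.mem_support_iff.2 hx₀⟩
  have hf : f ∈ orderGE k ht (ht x) := fun y hy => hmin y (Finsupp.mem_support_iff.2 hy)
  have h1 := mul_mem_orderGE hd hf
  -- At a point `x` of least degree in the support of `f`, only the leading term `1` of `d`
  -- contributes.
  have h2 : ((d - 1) * f).coeff x = 0 := by
    by_contra hc
    have := h1 x hc
    omega
  have h3 : (d * f).coeff x = f.coeff x := by
    have : d * f = (d - 1) * f + f := by ring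
    rw [this, AddMonoidAlgebra.coeff_add, Finsupp.add_apply, h2, zero_add]
  have h4 := h x (by rw [h3]; exact Finsupp.mem_support_iff.1 hx)
  have h5 := hmin x₀ (Finsupp.mem_support_iff.2 hx₀)
  omega

end Order

/-! ### Removing factors from a denominator -/

section Denominators

variable {R K : Type*} [CommRing R] [Field K] [Algebra R K] [IsFractionRing R K]

/-- The fractions that can be written with a denominator which is a nonzerodivisor modulo `e`. -/
def regularAlong (K : Type*) [Field K] [Algebra R K] (e : R) : Subring K where
  carrier := {x | ∃ d n : R, (∀ f, e ∣ d * f → e ∣ f) ∧ algebraMap R K d * x = algebraMap R K n}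
  zero_mem' := ⟨1, 0, by simp, by simp⟩
  one_mem' := ⟨1, 1, by simp, by simp⟩
  add_mem' := by
    rintro x y ⟨d, n, hd, hx⟩ ⟨d', n', hd', hy⟩
    refine ⟨d * d', d' * n + d * n', fun f hf => hd' f (hd _ (by rwa [← mul_assoc])), ?_⟩
    rw [map_add, map_mul, map_mul, map_mul, ← hx, ← hy]
    ring
  mul_mem' := by
    rintro x y ⟨d, n, hd, hx⟩ ⟨d', n', hd', hy⟩
    refine ⟨d * d', n * n', fun f hf => hd' f (hd _ (by rwa [← mul_assoc])), ?_⟩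
    rw [map_mul, map_mul, ← hx, ← hy]
    ring
  neg_mem' := by
    rintro x ⟨d, n, hd, hx⟩
    exact ⟨d, -n, hd, by rw [map_neg, mul_neg, hx]⟩

omit [IsFractionRing R K] in
lemma algebraMap_mem_regularAlong (e r : R) : algebraMap R K r ∈ regularAlong K e :=
  ⟨1, r, by simp, by simp⟩

lemma inv_mem_regularAlong {e d : R} (hd : ∀ f, e ∣ d * f → e ∣ f) (h0 : d ≠ 0) :
    (algebraMap R K d)⁻¹ ∈ regularAlong K e :=
  ⟨d, 1, hd, by
    rw [map_one, mul_inv_cancel₀]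
    exact (map_ne_zero_iff _ (IsFractionRing.injective R K)).2 h0⟩

/-- A factor `e` of a denominator can be omitted if the fraction is regular along `e`. -/
lemma mul_mem_range_of_mem_regularAlong {e m : R} {x : K} (he : e ≠ 0)
    (hx : x ∈ regularAlong K e)
    (h : algebraMap R K e * (algebraMap R K m * x) ∈ (algebraMap R K).range) :
    algebraMap R K m * x ∈ (algebraMap R K).range := by
  obtain ⟨d, n, hd, hx⟩ := hx
  obtain ⟨N, hN⟩ := h
  have hinj := IsFractionRing.injective R K
  have h1 : d * N = e * (m * n) := by
    apply hinj
    rw [map_mul, map_mul, map_mul, hN, ← hx]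
    ring
  obtain ⟨g, hg⟩ := hd N ⟨_, h1⟩
  refine ⟨g, ?_⟩
  rw [hg, map_mul] at hN
  exact mul_left_cancel₀ ((map_ne_zero_iff _ hinj).2 he) hN

lemma prod_mul_mem_range_of_mem_regularAlong {ι : Type*} (e : ι → R) {x : K}
    (s t : Finset ι) (he : ∀ i ∈ s, e i ≠ 0) (hx : ∀ i ∈ s, i ∉ t → x ∈ regularAlong K (e i))
    (h : (∏ i ∈ s, algebraMap R K (e i)) * x ∈ (algebraMap R K).range) :
    (∏ i ∈ t, algebraMap R K (e i)) * x ∈ (algebraMap R K).range := by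
  classical
  suffices (∏ i ∈ s ∩ t, algebraMap R K (e i)) * x ∈ (algebraMap R K).range by
    rw [← Finset.prod_sdiff (Finset.inter_subset_right (s₁ := s)), mul_assoc]
    refine Subring.mul_mem _ (Subring.prod_mem _ fun i _ => ⟨_, rfl⟩) this
  -- The extra multiplier `m` carries the factors not yet treated, so they can be removed one at a
  -- time without any coprimality.
  have key : ∀ m : R, (∏ i ∈ s, algebraMap R K (e i)) * (algebraMap R K m * x) ∈
      (algebraMap R K).range →
      (∏ i ∈ s ∩ t, algebraMap R K (e i)) * (algebraMap R K m * x) ∈ (algebraMap R K).range := by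
    clear h
    induction s using Finset.induction with
    | empty => simp
    | insert i s hi ih =>
      intro m hm
      have ih' := ih (fun j hj => he j (Finset.mem_insert_of_mem hj))
        (fun j hj => hx j (Finset.mem_insert_of_mem hj))
      rw [Finset.prod_insert hi] at hm
      by_cases hit : i ∈ t
      · rw [Finset.insert_inter_of_mem hit, Finset.prod_insert (by simp [hi])]
        have := ih' (e i * m) (by
          rw [map_mul]; convert hm using 1; ring)
        rw [map_mul] at this
        convert this using 1
        ring
      · rw [Finset.insert_inter_of_notMem hit]
        refine ih' m ?_
        have := mul_mem_range_of_mem_regularAlong (m := (∏ j ∈ s, e j) * m)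
          (he i (Finset.mem_insert_self i s)) (hx i (Finset.mem_insert_self i s) hit) (by
            rw [map_mul, map_prod]; convert hm using 1; ring)
        rw [map_mul, map_prod, mul_assoc] at this
        exact this
  simpa using key 1 (by simpa using h)

end Denominators

/-! ### The functions `c` and `φ`: inversion, congruences and behaviour at the ends of `T` -/

section Characters

variable {X : Type*} [AddCommGroup X]

open scoped LaurentPolynomial
open AddMonoidAlgebra

lemma mon_add (x y : X) : mon (x + y) = mon x * mon y := by
  rw [mon, mon, mon, ← map_mul, single_mul_single, one_mul]

@[simp] lemma mon_zero : mon (0 : X) = 1 := by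
  rw [mon, ← one_def, map_one]

lemma mon_mul_mon_neg (x : X) : mon x * mon (-x) = 1 := by
  rw [← mon_add, add_neg_cancel, mon_zero]

/-- The element `1 - y ^ x` of `O_q(T)`. -/
def oneSubMon (x : X) : TorusRing X := 1 - single x 1

lemma algebraMap_oneSubMon (x : X) :
    algebraMap (TorusRing X) (TorusField X) (oneSubMon x) = 1 - mon x := by
  rw [oneSubMon, map_sub, map_one, mon]

/-- The element `1 - q y ^ x` of `O_q(T)`. -/
def oneSubQMon (x : X) : TorusRing X := 1 - single x (LaurentPolynomial.T 1)

lemma algebraMap_oneSubQMon (x : X) :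
    algebraMap (TorusRing X) (TorusField X) (oneSubQMon x) = 1 - q X * mon x := by
  rw [oneSubQMon, map_sub, map_one, q, mon, ← map_mul, single_mul_single, zero_add, mul_one]

lemma oneSubMon_ne_zero {x : X} (hx : x ≠ 0) : oneSubMon x ≠ 0 := by
  rw [oneSubMon, sub_ne_zero, one_def]
  intro h
  have := congrArg (fun f => f.coeff 0) h
  simp [hx] at this

lemma oneSubQMon_ne_zero {x : X} (hx : x ≠ 0) : oneSubQMon x ≠ 0 := by
  rw [oneSubQMon, sub_ne_zero, one_def]
  intro h
  have := congrArg (fun f => f.coeff 0) h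
  simp [hx] at this

lemma algebraMap_torus_injective :
    Function.Injective (algebraMap (TorusRing X) (TorusField X)) :=
  IsFractionRing.injective _ _

lemma one_sub_mon_ne_zero {x : X} (hx : x ≠ 0) : 1 - mon x ≠ 0 := by
  rw [← algebraMap_oneSubMon, map_ne_zero_iff _ algebraMap_torus_injective]
  exact oneSubMon_ne_zero hx

lemma one_sub_q_mul_mon_ne_zero {x : X} (hx : x ≠ 0) : 1 - q X * mon x ≠ 0 := by
  rw [← algebraMap_oneSubQMon, map_ne_zero_iff _ algebraMap_torus_injective]
  exact oneSubQMon_ne_zero hx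

variable [Module.Free ℤ X]

/-- The coefficient `(1 - q) y ^ x / (1 - y ^ x)` of the recursion. -/
def recCoeff (x : X) : TorusField X := (1 - q X) * (mon x / (1 - mon x))

/-- The function `(1 - q y ^ x) / (1 - y ^ x)`. -/
def phi (x : X) : TorusField X := (1 - q X * mon x) / (1 - mon x)

lemma phi_ne_zero {x : X} (hx : x ≠ 0) : phi x ≠ 0 :=
  div_ne_zero (one_sub_q_mul_mon_ne_zero hx) (one_sub_mon_ne_zero hx)

omit [Module.Free ℤ X] in
lemma mon_ne_zero (x : X) : mon x ≠ 0 := left_ne_zero_of_mul_eq_one (mon_mul_mon_neg x)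

lemma mon_neg (x : X) : mon (-x) = (mon x)⁻¹ := eq_inv_of_mul_eq_one_right (mon_mul_mon_neg x)

/-- With `q_add_recCoeff_mul_recCoeff_neg` and the quadratic relation, this gives `(T + c(-x))(T +
c(x)) = φ(x) φ(-x)`: here the terms in `T` cancel, there the constant is computed. -/
lemma recCoeff_add_recCoeff_neg {x : X} (hx : x ≠ 0) :
    recCoeff x + recCoeff (-x) = -(1 - q X) := by
  have h1 := one_sub_mon_ne_zero hx
  have h2 := mon_ne_zero x
  have h3 : mon x - 1 ≠ 0 := by rw [← neg_sub]; exact neg_ne_zero.2 h1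
  have h4 : 1 - (mon x)⁻¹ = (mon x - 1) / mon x := by field_simp
  rw [recCoeff, recCoeff, mon_neg, h4]
  have h5 : 1 - mon x = -(mon x - 1) := by ring
  rw [h5]
  field_simp
  ring

lemma q_add_recCoeff_mul_recCoeff_neg {x : X} (hx : x ≠ 0) :
    q X + recCoeff x * recCoeff (-x) = phi x * phi (-x) := by
  have h1 := one_sub_mon_ne_zero hx
  have h2 := mon_ne_zero x
  have h3 : mon x - 1 ≠ 0 := by rw [← neg_sub]; exact neg_ne_zero.2 h1
  have h4 : 1 - (mon x)⁻¹ = (mon x - 1) / mon x := by field_simp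
  have h5 : 1 - mon x = -(mon x - 1) := by ring
  rw [recCoeff, recCoeff, phi, phi, mon_neg, h4, h5]
  field_simp
  ring

/-- The subring of fractions that are regular along the divisor `y ^ x = 1`. -/
abbrev regAlong (x : X) : Subring (TorusField X) := regularAlong (TorusField X) (oneSubMon x)

/-- Congruence modulo `1 - y ^ γ` among the fractions that are regular along `y ^ γ = 1`. -/
def CongrAlong (γ : X) (f g : TorusField X) : Prop :=
  ∃ h ∈ regAlong γ, f - g = (1 - mon γ) * h

lemma algebraMap_mem_regAlong (γ : X) (r : TorusRing X) :
    algebraMap (TorusRing X) (TorusField X) r ∈ regAlong γ := algebraMap_mem_regularAlong _ r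

lemma mon_mem_regAlong (γ x : X) : mon x ∈ regAlong γ := algebraMap_mem_regAlong γ _

lemma q_mem_regAlong (γ : X) : q X ∈ regAlong γ := algebraMap_mem_regAlong γ _

lemma one_sub_q_mem_regAlong (γ : X) : 1 - q X ∈ regAlong γ :=
  sub_mem (one_mem _) (q_mem_regAlong γ)

namespace CongrAlong

variable {γ : X} {f g f' g' : TorusField X}

lemma refl (f : TorusField X) : CongrAlong γ f f := ⟨0, zero_mem _, by ring⟩

lemma symm (h : CongrAlong γ f g) : CongrAlong γ g f := by
  obtain ⟨a, ha, h⟩ := h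
  exact ⟨-a, neg_mem ha, by rw [← neg_sub, h]; ring⟩

lemma add (h : CongrAlong γ f g) (h' : CongrAlong γ f' g') : CongrAlong γ (f + f') (g + g') := by
  obtain ⟨a, ha, h⟩ := h
  obtain ⟨a', ha', h'⟩ := h'
  exact ⟨a + a', add_mem ha ha', by linear_combination h + h'⟩

lemma mul (h : CongrAlong γ f g) (h' : CongrAlong γ f' g') (hf : f ∈ regAlong γ)
    (hg' : g' ∈ regAlong γ) : CongrAlong γ (f * f') (g * g') := by
  obtain ⟨a, ha, h⟩ := h
  obtain ⟨a', ha', h'⟩ := h'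
  exact ⟨f * a' + g' * a, add_mem (mul_mem hf ha') (mul_mem hg' ha),
    by linear_combination f * h' + g' * h⟩

lemma mul_left (h : CongrAlong γ f g) {a : TorusField X} (ha : a ∈ regAlong γ) :
    CongrAlong γ (a * f) (a * g) := by
  obtain ⟨c, hc, h⟩ := h
  exact ⟨a * c, mul_mem ha hc, by linear_combination a * h⟩

end CongrAlong

lemma congrAlong_mon_add_zsmul (γ x : X) (n : ℤ) : CongrAlong γ (mon (x + n • γ)) (mon x) := by
  obtain ⟨a, ha⟩ := one_sub_single_dvd_single_zsmul_sub γ x n (1 : ℂ[T;T⁻¹])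
  refine ⟨algebraMap _ _ a, algebraMap_mem_regAlong γ a, ?_⟩
  rw [mon, mon, ← map_sub, ha, map_mul, ← oneSubMon, algebraMap_oneSubMon]

/-- No nonzero multiple of `x` is a multiple of `γ`. -/
def Independent (x γ : X) : Prop := ∀ n : ℤ, n • x ∈ AddSubgroup.zmultiples γ → n = 0

variable {γ x : X}

omit [Module.Free ℤ X] in
lemma Independent.ne_zero (h : Independent x γ) : x ≠ 0 := by
  rintro rfl
  simpa using h 1 (by simp)

omit [Module.Free ℤ X] in
lemma Independent.add_zsmul (h : Independent x γ) (m : ℤ) : Independent (x + m • γ) γ := by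
  intro n hn
  refine h n ?_
  have h1 : n • x = n • (x + m • γ) - (n * m) • γ := by rw [smul_add, smul_smul]; abel
  rw [h1]
  exact sub_mem hn (AddSubgroup.zsmul_mem_zmultiples γ _)

lemma inv_one_sub_mon_mem (h : Independent x γ) : (1 - mon x)⁻¹ ∈ regAlong γ := by
  rw [← algebraMap_oneSubMon]
  exact inv_mem_regularAlong (fun f => dvd_of_dvd_one_sub_single_mul h _ f)
    (oneSubMon_ne_zero h.ne_zero)

lemma inv_one_sub_q_mul_mon_mem (h : Independent x γ) : (1 - q X * mon x)⁻¹ ∈ regAlong γ := by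
  rw [← algebraMap_oneSubQMon]
  exact inv_mem_regularAlong (fun f => dvd_of_dvd_one_sub_single_mul h _ f)
    (oneSubQMon_ne_zero h.ne_zero)

lemma recCoeff_mem (h : Independent x γ) : recCoeff x ∈ regAlong γ := by
  rw [recCoeff, div_eq_mul_inv]
  exact mul_mem (one_sub_q_mem_regAlong γ) (mul_mem (mon_mem_regAlong γ x) (inv_one_sub_mon_mem h))

lemma phi_mem (h : Independent x γ) : phi x ∈ regAlong γ := by
  rw [phi, div_eq_mul_inv]
  exact mul_mem (sub_mem (one_mem _) (mul_mem (q_mem_regAlong γ) (mon_mem_regAlong γ x)))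
    (inv_one_sub_mon_mem h)

lemma inv_phi_mem (h : Independent x γ) : (phi x)⁻¹ ∈ regAlong γ := by
  rw [phi, inv_div, div_eq_mul_inv]
  exact mul_mem (sub_mem (one_mem _) (mon_mem_regAlong γ x)) (inv_one_sub_q_mul_mon_mem h)

lemma congrAlong_inv_one_sub_mon (h : Independent x γ) (n : ℤ) :
    CongrAlong γ (1 - mon (x + n • γ))⁻¹ (1 - mon x)⁻¹ := by
  have h' := h.add_zsmul n
  obtain ⟨a, ha, h1⟩ := congrAlong_mon_add_zsmul γ x n
  refine ⟨a * ((1 - mon (x + n • γ))⁻¹ * (1 - mon x)⁻¹),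
    mul_mem ha (mul_mem (inv_one_sub_mon_mem h') (inv_one_sub_mon_mem h)), ?_⟩
  rw [← mul_assoc, ← h1]
  have := one_sub_mon_ne_zero h.ne_zero
  have := one_sub_mon_ne_zero h'.ne_zero
  field_simp
  ring

/-- The characters `x` and `x + nγ` agree where `y^γ = 1`, and the denominators do not vanish
identically on any component of that locus. -/
lemma congrAlong_recCoeff (h : Independent x γ) (n : ℤ) :
    CongrAlong γ (recCoeff (x + n • γ)) (recCoeff x) := by
  rw [recCoeff, recCoeff, div_eq_mul_inv, div_eq_mul_inv]
  exact ((congrAlong_mon_add_zsmul γ x n).mul (congrAlong_inv_one_sub_mon h n)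
    (mon_mem_regAlong _ _) (inv_one_sub_mon_mem h)).mul_left (one_sub_q_mem_regAlong γ)

lemma congrAlong_phi (h : Independent x γ) (n : ℤ) :
    CongrAlong γ (phi (x + n • γ)) (phi x) := by
  have h1 : ∀ y : X, phi y = (1 + (-q X) * mon y) * (1 - mon y)⁻¹ := fun y => by
    rw [phi, div_eq_mul_inv]; ring
  have hq : ∀ y : X, 1 + (-q X) * mon y ∈ regAlong γ := fun y =>
    add_mem (one_mem _) (mul_mem (neg_mem (q_mem_regAlong γ)) (mon_mem_regAlong γ y))
  rw [h1, h1]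
  exact ((CongrAlong.refl 1).add ((congrAlong_mon_add_zsmul γ x n).mul_left
    (neg_mem (q_mem_regAlong γ)))).mul (congrAlong_inv_one_sub_mon h n) (hq _)
    (inv_one_sub_mon_mem h)

/-- The fractions of order at least `n` with respect to the grading `ht`, with a denominator whose
leading term is `1`. -/
def orderFrac (ht : X →+ ℤ) (n : ℤ) : AddSubgroup (TorusField X) where
  carrier := {x | ∃ d m : TorusRing X, d - 1 ∈ orderGE ℂ[T;T⁻¹] ht 1 ∧ m ∈ orderGE ℂ[T;T⁻¹] ht n ∧
    algebraMap _ _ d * x = algebraMap (TorusRing X) (TorusField X) m}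
  zero_mem' := ⟨1, 0, by simp, zero_mem _, by simp⟩
  add_mem' := by
    rintro x y ⟨d, m, hd, hm, hx⟩ ⟨d', m', hd', hm', hy⟩
    have h0 := one_mem_orderGE (k := ℂ[T;T⁻¹]) (ht := ht)
    have h1 : d ∈ orderGE ℂ[T;T⁻¹] ht 0 := by
      simpa using add_mem (orderGE_mono zero_le_one hd) h0
    have h1' : d' ∈ orderGE ℂ[T;T⁻¹] ht 0 := by
      simpa using add_mem (orderGE_mono zero_le_one hd') h0
    refine ⟨d * d', d' * m + d * m', ?_, ?_, ?_⟩
    · have : d * d' - 1 = (d - 1) * d' + (d' - 1) := by ring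
      rw [this]
      exact add_mem (by simpa using mul_mem_orderGE hd h1') hd'
    · exact add_mem (by simpa using mul_mem_orderGE h1' hm) (by simpa using mul_mem_orderGE h1 hm')
    · rw [map_add, map_mul, map_mul, map_mul, ← hx, ← hy]
      ring
  neg_mem' := by
    rintro x ⟨d, m, hd, hm, hx⟩
    exact ⟨d, -m, hd, neg_mem hm, by rw [map_neg, mul_neg, hx]⟩

variable {ht : X →+ ℤ}

omit [Module.Free ℤ X] in
lemma mul_mem_orderFrac {m n : ℤ} {f g : TorusField X} (hf : f ∈ orderFrac ht m)
    (hg : g ∈ orderFrac ht n) : f * g ∈ orderFrac ht (m + n) := by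
  obtain ⟨d, a, hd, hm, hx⟩ := hf
  obtain ⟨d', a', hd', hm', hy⟩ := hg
  have h1' : d' ∈ orderGE ℂ[T;T⁻¹] ht 0 := by
    simpa using add_mem (orderGE_mono zero_le_one hd') one_mem_orderGE
  refine ⟨d * d', a * a', ?_, mul_mem_orderGE hm hm', ?_⟩
  · have : d * d' - 1 = (d - 1) * d' + (d' - 1) := by ring
    rw [this]
    exact add_mem (by simpa using mul_mem_orderGE hd h1') hd'
  · rw [map_mul, map_mul, ← hx, ← hy]
    ring

omit [Module.Free ℤ X] in
lemma orderFrac_mono {m n : ℤ} (h : m ≤ n) {f : TorusField X} (hf : f ∈ orderFrac ht n) :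
    f ∈ orderFrac ht m := by
  obtain ⟨d, a, hd, hm, hx⟩ := hf
  exact ⟨d, a, hd, orderGE_mono h hm, hx⟩

-- Denominators with leading term `1` do not shift the order, so the order of a regular function can
-- be read off from any presentation as a fraction.
omit [Module.Free ℤ X] in
lemma algebraMap_mem_orderFrac {n : ℤ} {f : TorusRing X} :
    algebraMap _ (TorusField X) f ∈ orderFrac ht n ↔ f ∈ orderGE ℂ[T;T⁻¹] ht n := by
  constructor
  · rintro ⟨d, a, hd, ha, h⟩
    rw [← map_mul, algebraMap_torus_injective.eq_iff] at h
    exact mem_orderGE_of_mul_mem hd (by rwa [h])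
  · intro h
    exact ⟨1, f, by simp, h, by simp⟩

omit [Module.Free ℤ X] in
lemma one_mem_orderFrac : (1 : TorusField X) ∈ orderFrac ht 0 := by
  rw [← map_one (algebraMap (TorusRing X) (TorusField X)), algebraMap_mem_orderFrac]
  exact one_mem_orderGE

omit [Module.Free ℤ X] in
lemma q_mem_orderFrac : q X ∈ orderFrac ht 0 := by
  rw [q, algebraMap_mem_orderFrac]
  exact single_mem_orderGE (by simp) _

omit [Module.Free ℤ X] in
lemma one_sub_q_mem_orderFrac : 1 - q X ∈ orderFrac ht 0 :=
  sub_mem one_mem_orderFrac q_mem_orderFrac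

omit [Module.Free ℤ X] in
lemma mon_mem_orderFrac {n : ℤ} {x : X} (hx : n ≤ ht x) : mon x ∈ orderFrac ht n := by
  rw [mon, algebraMap_mem_orderFrac]
  exact single_mem_orderGE hx _

lemma inv_one_sub_mon_mem_orderFrac {x : X} (hx : 1 ≤ ht x) :
    (1 - mon x)⁻¹ ∈ orderFrac ht 0 := by
  refine ⟨oneSubMon x, 1, ?_, one_mem_orderGE, ?_⟩
  · rw [oneSubMon, sub_sub_cancel_left]
    exact neg_mem (single_mem_orderGE hx 1)
  · rw [algebraMap_oneSubMon, map_one, mul_inv_cancel₀]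
    refine one_sub_mon_ne_zero ?_
    rintro rfl
    simp at hx

lemma recCoeff_mem_orderFrac {x : X} (hx : 1 ≤ ht x) : recCoeff x ∈ orderFrac ht 1 := by
  rw [recCoeff, div_eq_mul_inv]
  simpa using mul_mem_orderFrac one_sub_q_mem_orderFrac
    (mul_mem_orderFrac (mon_mem_orderFrac hx) (inv_one_sub_mon_mem_orderFrac hx))

/-- As `y^x` tends to infinity, `c(x) = -(1 - q) - c(-x)` tends to `-(1 - q)`, so it stays bounded.
-/
lemma recCoeff_mem_orderFrac_neg {x : X} (hx : 1 ≤ ht x) : recCoeff x ∈ orderFrac (-ht) 0 := by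
  have h0 : x ≠ 0 := by rintro rfl; simp at hx
  have h1 : recCoeff x = -(1 - q X) - recCoeff (-x) := by
    rw [← recCoeff_add_recCoeff_neg h0]; ring
  rw [h1]
  exact sub_mem (neg_mem one_sub_q_mem_orderFrac)
    (orderFrac_mono zero_le_one (recCoeff_mem_orderFrac (by simpa using hx)))

omit [Module.Free ℤ X] in
/-- A regular function that vanishes at one end of `T` and is bounded at the other end is zero. -/
lemma eq_zero_of_mem_orderFrac {f : TorusField X}
    (hf : f ∈ (algebraMap (TorusRing X) (TorusField X)).range) (h1 : f ∈ orderFrac ht 1)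
    (h2 : f ∈ orderFrac (-ht) 0) : f = 0 := by
  obtain ⟨g, rfl⟩ := hf
  rw [algebraMap_mem_orderFrac] at h1 h2
  have : g = 0 := by
    ext x : 2
    by_contra hx
    have h3 := h1 x hx
    have h4 := h2 x hx
    rw [AddMonoidHom.neg_apply] at h4
    omega
  rw [this, map_zero]

end Characters

/-! ### Words in the Iwahori-Hecke algebra -/

section Words

variable {ι X Y : Type*} [AddCommGroup X] [AddCommGroup Y] [Module.Free ℤ X] {P : RootDatum ι X Y}
  {b : P.Base}

open scoped Classical in
/-- Left multiplication by the generator with index `i` of the Iwahori-Hecke algebra, with quadratic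
relation `(T - 1) (T + q) = 0`, in terms of the coefficients in the standard basis. -/
def heckeOp (b : P.Base) (i : ι) (f : P.weylGroup → TorusField X) (u : P.weylGroup) :
    TorusField X :=
  if b.IsPos (u⁻¹ • i) then q X * f (refl P i * u) else (1 - q X) * f u + f (refl P i * u)

omit [Module.Free ℤ X] in
lemma heckeOp_of_isPos {i : ι} {u : P.weylGroup} (h : b.IsPos (u⁻¹ • i))
    (f : P.weylGroup → TorusField X) : heckeOp b i f u = q X * f (refl P i * u) := if_pos h

omit [Module.Free ℤ X] in
lemma heckeOp_of_not_isPos {i : ι} {u : P.weylGroup} (h : ¬ b.IsPos (u⁻¹ • i))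
    (f : P.weylGroup → TorusField X) :
    heckeOp b i f u = (1 - q X) * f u + f (refl P i * u) := if_neg h

omit [Module.Free ℤ X] in
lemma isPos_refl_mul_inv_smul (i : ι) (u : P.weylGroup) :
    b.IsPos ((refl P i * u)⁻¹ • i) ↔ ¬ b.IsPos (u⁻¹ • i) := by
  rw [mul_inv_rev, refl_inv, mul_smul, isPos_smul_refl_smul_self]

omit [Module.Free ℤ X] in
/-- The quadratic relation. -/
lemma heckeOp_heckeOp (i : ι) (f : P.weylGroup → TorusField X) (u : P.weylGroup) :
    heckeOp b i (heckeOp b i f) u = (1 - q X) * heckeOp b i f u + q X * f u := by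
  have h' := isPos_refl_mul_inv_smul (b := b) i u
  by_cases h : b.IsPos (u⁻¹ • i)
  · rw [heckeOp_of_isPos h, heckeOp_of_isPos h, heckeOp_of_not_isPos fun h1 => h'.1 h1 h,
      refl_mul_refl_mul]
    ring
  · rw [heckeOp_of_not_isPos h, heckeOp_of_not_isPos h, heckeOp_of_isPos (h'.2 h),
      refl_mul_refl_mul]

omit [Module.Free ℤ X] in
lemma heckeOp_linear (i : ι) (f g : P.weylGroup → TorusField X) (a c : TorusField X)
    (u : P.weylGroup) :
    heckeOp b i (fun u => a * f u + c * g u) u = a * heckeOp b i f u + c * heckeOp b i g u := by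
  by_cases h : b.IsPos (u⁻¹ • i)
  · simp only [heckeOp_of_isPos h]; ring
  · simp only [heckeOp_of_not_isPos h]; ring

omit [Module.Free ℤ X] in
lemma heckeOp_mul (i : ι) (f : P.weylGroup → TorusField X) (a : TorusField X) (u : P.weylGroup) :
    heckeOp b i (fun u => a * f u) u = a * heckeOp b i f u := by
  simpa using heckeOp_linear (b := b) i f f a 0 u

-- Only stability under addition and under `q` is asked, so that regular functions, functions
-- regular along a divisor and functions of bounded order are all covered.
omit [Module.Free ℤ X] in
lemma heckeOp_mem {S : Type*} [SetLike S (TorusField X)] [AddSubgroupClass S (TorusField X)]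
    (A : S) (hA : ∀ x ∈ A, q X * x ∈ A) (i : ι) {f : P.weylGroup → TorusField X}
    (hf : ∀ u, f u ∈ A) (u : P.weylGroup) : heckeOp b i f u ∈ A := by
  by_cases h : b.IsPos (u⁻¹ • i)
  · rw [heckeOp_of_isPos h]
    exact hA _ (hf _)
  · rw [heckeOp_of_not_isPos h, sub_mul, one_mul]
    exact add_mem (sub_mem (hf _) (hA _ (hf _))) (hf _)

open scoped Classical in
/-- The product `∏ (T_i + c(β))` over the letters of a word, where `β` is the root attached to the
letter, in terms of its coefficients in the standard basis of the Iwahori-Hecke algebra. -/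
def wordVec {b : P.Base} : List b.support → P.weylGroup → TorusField X
  | [], u => if u = 1 then 1 else 0
  | i :: l, u => heckeOp b i (wordVec l) u +
      recCoeff (P.root ((wprod l)⁻¹ • (i : ι))) * wordVec l u

lemma wordVec_cons (i : b.support) (l : List b.support) (u : P.weylGroup) :
    wordVec (i :: l) u = heckeOp b i (wordVec l) u +
      recCoeff (P.root ((wprod l)⁻¹ • (i : ι))) * wordVec l u := rfl

/-- The product of the functions `φ(β)` over the letters of a word. -/
def wordPhi {b : P.Base} (l : List b.support) : TorusField X :=
  ((rootsOf l).map fun β => phi (P.root β)).prod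

lemma wordPhi_cons (i : b.support) (l : List b.support) :
    wordPhi (i :: l) = phi (P.root ((wprod l)⁻¹ • (i : ι))) * wordPhi l := by
  simp [wordPhi, rootsOf]

/-- The vector of a word, normalized so as to depend on the product of the word only. -/
def normVec {b : P.Base} (l : List b.support) (u : P.weylGroup) : TorusField X :=
  wordVec l u / wordPhi l

lemma phi_root_ne_zero (i : ι) : phi (P.root i) ≠ 0 := phi_ne_zero (P.ne_zero i)

lemma wordPhi_ne_zero (l : List b.support) : wordPhi l ≠ 0 := by
  rw [wordPhi, Ne, List.prod_eq_zero_iff, List.mem_map]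
  rintro ⟨β, -, h⟩
  exact phi_root_ne_zero β h

lemma wordVec_eq (l : List b.support) (u : P.weylGroup) :
    wordVec l u = wordPhi l * normVec l u := by
  rw [normVec, mul_div_cancel₀ _ (wordPhi_ne_zero l)]

/-- The tail enters only through its normalized vector and its product, so equalities between tails
pass to longer words. -/
lemma normVec_cons (i : b.support) (l : List b.support) (u : P.weylGroup) :
    normVec (i :: l) u = (heckeOp b i (normVec l) u +
      recCoeff (P.root ((wprod l)⁻¹ • (i : ι))) * normVec l u) /
        phi (P.root ((wprod l)⁻¹ • (i : ι))) := by
  have h : normVec l = fun u => (wordPhi l)⁻¹ * wordVec l u := by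
    ext u; rw [normVec, div_eq_inv_mul]
  rw [h, heckeOp_mul, normVec, wordVec_cons, wordPhi_cons]
  have := wordPhi_ne_zero l
  have := phi_root_ne_zero (P := P) ((wprod l)⁻¹ • (i : ι))
  field_simp

lemma normVec_cons_congr (i : b.support) {l l' : List b.support} (h : wprod l = wprod l')
    (h' : normVec l = normVec l') : normVec (i :: l) = normVec (i :: l') := by
  ext u
  rw [normVec_cons, normVec_cons, h, h']

/-- The second copy of the letter carries the root `-β`, and `(T_i + c(-β))(T_i + c(β))` is the
scalar `φ(β) φ(-β)` that the normalization divides out. -/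
lemma normVec_cons_cons (i : b.support) (l : List b.support) :
    normVec (i :: i :: l) = normVec l := by
  ext u
  have h0 := P.ne_zero ((wprod l)⁻¹ • (i : ι))
  have h1 : P.root ((wprod (i :: l))⁻¹ • (i : ι)) = -P.root ((wprod l)⁻¹ • (i : ι)) := by
    rw [wprod_cons, mul_inv_rev, refl_inv, mul_smul, root_smul_refl_smul_self]
  have h2 := recCoeff_add_recCoeff_neg h0
  have h3 := q_add_recCoeff_mul_recCoeff_neg h0
  have h4 : wordVec (i :: l) = fun u => 1 * heckeOp b i (wordVec l) u +
      recCoeff (P.root ((wprod l)⁻¹ • (i : ι))) * wordVec l u := by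
    ext u; rw [wordVec_cons, one_mul]
  have h5 : wordVec (i :: i :: l) u = phi (P.root ((wprod l)⁻¹ • (i : ι))) *
      phi (-P.root ((wprod l)⁻¹ • (i : ι))) * wordVec l u := by
    rw [wordVec_cons, h1, h4, heckeOp_linear, heckeOp_heckeOp, ← h3]
    linear_combination heckeOp b i (wordVec l) u * h2
  rw [normVec, h5, wordPhi_cons, wordPhi_cons, h1, normVec]
  have h6 := wordPhi_ne_zero l
  have h7 := phi_ne_zero h0
  have h8 := phi_ne_zero (neg_ne_zero.2 h0)
  field_simp

lemma prod_one_sub_mon_mul_wordVec_mem (l : List b.support) (u : P.weylGroup) :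
    ((rootsOf l).map fun β => 1 - mon (P.root β)).prod * wordVec l u ∈
      (algebraMap (TorusRing X) (TorusField X)).range := by
  have hq : q X ∈ (algebraMap (TorusRing X) (TorusField X)).range := ⟨_, rfl⟩
  have hmon (x : X) : mon x ∈ (algebraMap (TorusRing X) (TorusField X)).range := ⟨_, rfl⟩
  induction l generalizing u with
  | nil =>
    rw [wordVec]
    split_ifs
    · simp [rootsOf]
    · simp
  | cons i l ih =>
    set β := (wprod l)⁻¹ • (i : ι) with hβ
    set p := ((rootsOf l).map fun β => 1 - mon (P.root β)).prod
    have h1 : ((rootsOf (i :: l)).map fun β => 1 - mon (P.root β)).prod * wordVec (i :: l) u =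
        (1 - mon (P.root β)) * heckeOp b i (fun u => p * wordVec l u) u +
          (1 - q X) * mon (P.root β) * (p * wordVec l u) := by
      rw [heckeOp_mul, wordVec_cons, rootsOf, List.map_cons, List.prod_cons, recCoeff, ← hβ]
      have := one_sub_mon_ne_zero (P.ne_zero β)
      field_simp
      ring
    rw [h1]
    exact add_mem (mul_mem (sub_mem (one_mem _) (hmon _))
      (heckeOp_mem (b := b) _ (fun x hx => mul_mem hq hx) i ih u))
      (mul_mem (mul_mem (sub_mem (one_mem _) hq) (hmon _)) (ih u))

end Words

/-! ### Residues along `y^γ = 1` -/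

section Residues

variable {ι X Y : Type*} [AddCommGroup X] [AddCommGroup Y] [Module.Free ℤ X] {P : RootDatum ι X Y}
  {b : P.Base}

lemma wordVec_mem_regAlong {l : List b.support} {γ : X}
    (h : ∀ β ∈ rootsOf l, Independent (P.root β) γ) (u : P.weylGroup) :
    wordVec l u ∈ regAlong γ := by
  induction l generalizing u with
  | nil =>
    rw [wordVec]
    split_ifs
    · exact one_mem _
    · exact zero_mem _
  | cons i l ih =>
    have ih' := ih fun β hβ => h β (List.mem_cons_of_mem _ hβ)
    exact add_mem (heckeOp_mem (b := b) _ (fun x hx => mul_mem (q_mem_regAlong γ) hx) i ih' u)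
      (mul_mem (recCoeff_mem (h _ List.mem_cons_self)) (ih' u))

omit [Module.Free ℤ X] in
lemma root_refl_smul (γ β : ι) :
    ∃ n : ℤ, P.root (refl P γ • β) = P.root β + n • P.root γ :=
  ⟨-P.pairing β γ, by
    rw [refl_smul, RootPairing.root_reflectionPerm, RootPairing.reflection_apply_root, neg_smul,
      sub_eq_add_neg]⟩

omit [Module.Free ℤ X] in
lemma rootsFrom_mul_refl (l : List b.support) (w : P.weylGroup) (γ : ι) :
    rootsFrom l (w * refl P γ) = (rootsFrom l w).map (refl P γ • ·) := by
  induction l with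
  | nil => rfl
  | cons i l ih =>
    rw [rootsFrom, rootsFrom, ih, List.map_cons, ← mul_assoc, mul_inv_rev, refl_inv, mul_smul]

omit [Module.Free ℤ X] in
lemma independent_refl_smul {γ β : ι} (h : Independent (P.root β) (P.root γ)) :
    Independent (P.root (refl P γ • β)) (P.root γ) := by
  obtain ⟨n, hn⟩ := root_refl_smul (P := P) γ β
  rw [hn]
  exact h.add_zsmul n

lemma prod_phi_mem {L : List ι} {γ : X} (h : ∀ β ∈ L, Independent (P.root β) γ) :
    (L.map fun β => phi (P.root β)).prod ∈ regAlong γ := by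
  refine list_prod_mem fun x hx => ?_
  obtain ⟨β, hβ, rfl⟩ := List.mem_map.1 hx
  exact phi_mem (h β hβ)

lemma congrAlong_prod_phi_refl_smul {L : List ι} {γ : ι}
    (h : ∀ β ∈ L, Independent (P.root β) (P.root γ)) :
    CongrAlong (P.root γ) ((L.map (refl P γ • ·)).map fun β => phi (P.root β)).prod
      (L.map fun β => phi (P.root β)).prod := by
  induction L with
  | nil => exact CongrAlong.refl _
  | cons β L ih =>
    have h1 := h β List.mem_cons_self
    have h2 : ∀ β ∈ L, Independent (P.root β) (P.root γ) :=
      fun δ hδ => h δ (List.mem_cons_of_mem _ hδ)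
    obtain ⟨n, hn⟩ := root_refl_smul (P := P) γ β
    rw [List.map_cons, List.map_cons, List.map_cons, List.prod_cons, List.prod_cons, hn]
    exact (congrAlong_phi h1 n).mul (ih h2) (phi_mem (h1.add_zsmul n)) (prod_phi_mem h2)

lemma congrAlong_heckeOp {γ : X} {f g : P.weylGroup → TorusField X}
    (h : ∀ u, CongrAlong γ (f u) (g u)) (i : ι) (u : P.weylGroup) :
    CongrAlong γ (heckeOp b i f u) (heckeOp b i g u) := by
  by_cases hi : b.IsPos (u⁻¹ • i)
  · rw [heckeOp_of_isPos hi, heckeOp_of_isPos hi]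
    exact (h _).mul_left (q_mem_regAlong γ)
  · rw [heckeOp_of_not_isPos hi, heckeOp_of_not_isPos hi]
    exact ((h _).mul_left (one_sub_q_mem_regAlong γ)).add (h _)

/-- Omitting a letter gives the residue of the vector of a word along the root of that letter. -/
lemma congrAlong_wordVec_append (l l' : List b.support) (j : b.support) {γ : ι}
    (hγ : γ = (wprod l')⁻¹ • (j : ι))
    (h : ∀ β ∈ rootsFrom l (wprod (j :: l')), Independent (P.root β) (P.root γ))
    (h' : ∀ β ∈ rootsOf l', Independent (P.root β) (P.root γ)) (u : P.weylGroup) :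
    wordVec (l ++ l') u ∈ regAlong (P.root γ) ∧
    CongrAlong (P.root γ) ((1 - mon (P.root γ)) * wordVec (l ++ j :: l') u)
      ((1 - q X) * wordVec (l ++ l') u) := by
  induction l generalizing u with
  | nil =>
    have hmem := wordVec_mem_regAlong h'
    -- The witness comes from `(1 - y^γ)(T_j + c(γ)) = (1 - q) + (1 - y^γ)(T_j - (1 - q))`.
    refine ⟨hmem u, heckeOp b j (wordVec l') u - (1 - q X) * wordVec l' u, ?_, ?_⟩
    · exact sub_mem (heckeOp_mem (b := b) _ (fun x hx => mul_mem (q_mem_regAlong _) hx) j hmem u)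
        (mul_mem (one_sub_q_mem_regAlong _) (hmem u))
    · rw [List.nil_append, List.nil_append, wordVec_cons, ← hγ, recCoeff]
      have := one_sub_mon_ne_zero (P.ne_zero γ)
      field_simp
      ring
  | cons i l ih =>
    have ih' := ih fun β hβ => h β (List.mem_cons_of_mem _ hβ)
    set β := (wprod (l ++ j :: l'))⁻¹ • (i : ι) with hβ
    have hβind : Independent (P.root β) (P.root γ) := by
      refine h β ?_
      rw [rootsFrom, ← wprod_append]
      exact List.mem_cons_self
    -- Deleting the letter of `γ` moves the root of each earlier letter by `r_γ`, hence by a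
    -- multiple of `γ`, which does not affect `c` modulo `1 - y^γ`.
    have hβ' : (wprod (l ++ l'))⁻¹ • (i : ι) = refl P γ • β := by
      rw [wprod_append_eq_mul_refl l l' j, ← hγ, mul_inv_rev, refl_inv, mul_smul]
    obtain ⟨n, hn⟩ := root_refl_smul (P := P) γ β
    have hc := congrAlong_recCoeff hβind n
    rw [← hn] at hc
    have hcmem := recCoeff_mem (independent_refl_smul hβind)
    rw [List.cons_append, List.cons_append, wordVec_cons, wordVec_cons, ← hβ, hβ', mul_add, mul_add,
      ← heckeOp_mul, ← heckeOp_mul, mul_left_comm, mul_left_comm (1 - q X)]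
    refine ⟨add_mem (heckeOp_mem (b := b) _ (fun x hx => mul_mem (q_mem_regAlong _) hx) i
      (fun u => (ih' u).1) u) (mul_mem hcmem (ih' u).1), ?_⟩
    exact (congrAlong_heckeOp (fun u => (ih' u).2) i u).add
      (hc.symm.mul (ih' u).2 (recCoeff_mem hβind)
        (mul_mem (one_sub_q_mem_regAlong _) (ih' u).1))

variable [Fintype ι] [P.IsReduced]

omit [Module.Free ℤ X] [Fintype ι] in
lemma independent_root {β γ : ι} (hβ : b.IsPos β) (hγ : b.IsPos γ) (h : β ≠ γ) :
    Independent (P.root β) (P.root γ) := fun n hn =>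
  zsmul_root_notMem_zmultiples (fun h1 => h (P.root.injective h1))
    (fun h1 => (isPos_iff_not_of_root_eq_neg h1).1 hβ hγ) n hn

-- The letter attached to `γ` is omitted; the resulting word need not be reduced. Its normalizing
-- factor is compared with a product over the other inversions because that product depends only on
-- `wprod l` and `γ`, so the residues of two reduced words can be compared.
open scoped Classical in
lemma IsReducedWord.exists_residue {l : List b.support} (hl : IsReducedWord l) {γ : ι}
    (hγ : γ ∈ inversions b (wprod l)) :
    ∃ l' : List b.support, l'.length + 1 = l.length ∧ wprod l' = wprod l * refl P γ ∧
      CongrAlong (P.root γ) (wordPhi l')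
        (∏ β ∈ (inversions b (wprod l)).erase γ, phi (P.root β)) ∧
      ∀ u, wordVec l' u ∈ regAlong (P.root γ) ∧
        CongrAlong (P.root γ) ((1 - mon (P.root γ)) * wordVec l u)
          ((1 - q X) * wordVec l' u) := by
  obtain ⟨hnd, hmem⟩ := hl.nodup_and_mem
  have hprod := hl.prod_rootsOf fun β => phi (P.root β)
  rw [← Finset.mul_prod_erase _ _ hγ] at hprod
  have hpos : ∀ β ∈ rootsOf l, b.IsPos β := fun β hβ => (mem_inversions.1 ((hmem β).1 hβ)).1
  have hγpos := (mem_inversions.1 hγ).1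
  obtain ⟨l₁, l₂, j, rfl, hj⟩ := exists_append_of_mem_rootsOf ((hmem γ).2 hγ)
  rw [rootsOf_append] at hnd hpos hprod
  rw [rootsOf, ← hj] at hnd hpos hprod
  have h1 : ∀ β ∈ rootsFrom l₁ (wprod (j :: l₂)), Independent (P.root β) (P.root γ) := by
    intro β hβ
    refine independent_root (hpos β (List.mem_append_left _ hβ)) hγpos ?_
    rintro rfl
    exact (List.disjoint_of_nodup_append hnd) hβ List.mem_cons_self
  have h2 : ∀ β ∈ rootsOf l₂, Independent (P.root β) (P.root γ) := by
    intro β hβ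
    refine independent_root
      (hpos β (List.mem_append_right _ (List.mem_cons_of_mem _ hβ))) hγpos ?_
    rintro rfl
    exact (List.nodup_cons.1 hnd.of_append_right).1 hβ
  refine ⟨l₁ ++ l₂, by simp [add_assoc], ?_, ?_, congrAlong_wordVec_append l₁ l₂ j hj h1 h2⟩
  · rw [hj]
    exact wprod_append_eq_mul_refl l₁ l₂ j
  · have h3 : ∏ β ∈ (inversions b (wprod (l₁ ++ j :: l₂))).erase γ, phi (P.root β) =
        ((rootsFrom l₁ (wprod (j :: l₂))).map fun β => phi (P.root β)).prod *
          ((rootsOf l₂).map fun β => phi (P.root β)).prod := by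
      apply mul_left_cancel₀ (phi_root_ne_zero (P := P) γ)
      rw [← hprod, List.map_append, List.prod_append, List.map_cons, List.prod_cons]
      ring
    have h4 : wprod l₂ = wprod (j :: l₂) * refl P γ := by
      rw [hj]
      exact wprod_append_eq_mul_refl [] l₂ j
    rw [h3, wordPhi, rootsOf_append, List.map_append, List.prod_append, h4, rootsFrom_mul_refl]
    refine (congrAlong_prod_phi_refl_smul h1).mul (CongrAlong.refl _) ?_ (prod_phi_mem h2)
    refine prod_phi_mem fun β hβ => ?_
    obtain ⟨δ, hδ, rfl⟩ := List.mem_map.1 hβ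
    exact independent_refl_smul (h1 δ hδ)

end Residues

/-! ### Independence of the word, and the theorem -/

section Canonical

variable {ι X Y : Type*} [AddCommGroup X] [AddCommGroup Y] [Module.Free ℤ X] {P : RootDatum ι X Y}
  {b : P.Base} [Fintype ι] [P.IsReduced]

omit [Module.Free ℤ X] [Fintype ι] [P.IsReduced] in
open scoped Classical in
lemma heckeOp_single {i : ι} {w : P.weylGroup} (h : b.IsPos (w⁻¹ • i)) (u : P.weylGroup) :
    heckeOp b i (fun u => if u = w then 1 else 0) u = if u = refl P i * w then 1 else 0 := by
  have h1 : refl P i * u = w ↔ u = refl P i * w :=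
    ⟨fun h => by rw [← h, refl_mul_refl_mul], fun h => by rw [h, refl_mul_refl_mul]⟩
  by_cases hu : b.IsPos (u⁻¹ • i)
  · have h2 : ¬ u = refl P i * w := by
      rintro rfl
      exact (isPos_refl_mul_inv_smul i w).1 hu h
    rw [heckeOp_of_isPos hu]
    simp only [h1, h2, if_false, mul_zero]
  · have h2 : u ≠ w := by rintro rfl; exact hu h
    rw [heckeOp_of_not_isPos hu]
    simp only [h1, h2, if_false, mul_zero, zero_add]

omit [Module.Free ℤ X] in
lemma IsReducedWord.one_le_posPairing {i : b.support} {l : List b.support}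
    (hl : IsReducedWord (i :: l)) : 1 ≤ posPairing b (P.root ((wprod l)⁻¹ • (i : ι))) :=
  posPairing_pos hl.isPos

lemma IsReducedWord.wordVec_mem_orderFrac_neg {l : List b.support} (hl : IsReducedWord l)
    (u : P.weylGroup) : wordVec l u ∈ orderFrac (-posPairing b) 0 := by
  induction l generalizing u with
  | nil =>
    rw [wordVec]
    split_ifs
    · exact one_mem_orderFrac
    · exact zero_mem _
  | cons i l ih =>
    refine add_mem (heckeOp_mem (b := b) _ (fun x hx => ?_) i (ih hl.tail) u) ?_
    · simpa using mul_mem_orderFrac q_mem_orderFrac hx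
    · simpa using mul_mem_orderFrac (recCoeff_mem_orderFrac_neg hl.one_le_posPairing)
        (ih hl.tail u)

-- The roots of a reduced word are positive, so at the end of `T` where their characters tend to `0`
-- every `c(β)` vanishes and the product tends to `T_w`.
open scoped Classical in
lemma IsReducedWord.wordVec_sub_mem_orderFrac {l : List b.support} (hl : IsReducedWord l)
    (u : P.weylGroup) :
    wordVec l u - (if u = wprod l then 1 else 0) ∈ orderFrac (posPairing b) 1 := by
  induction l generalizing u with
  | nil =>
    rw [wordVec, wprod_nil, sub_self]
    exact zero_mem _
  | cons i l ih =>
    have ih' := ih hl.tail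
    have h1 : wordVec l u ∈ orderFrac (posPairing b) 0 := by
      have h2 : (if u = wprod l then 1 else 0 : TorusField X) ∈ orderFrac (posPairing b) 0 := by
        split_ifs
        · exact one_mem_orderFrac
        · exact zero_mem _
      simpa using add_mem (orderFrac_mono zero_le_one (ih' u)) h2
    have h2 : heckeOp b i (wordVec l) u - (if u = wprod (i :: l) then 1 else 0) =
        heckeOp b i (fun u => 1 * wordVec l u + (-1) * (if u = wprod l then 1 else 0)) u := by
      rw [heckeOp_linear, wprod_cons, heckeOp_single hl.isPos]
      ring
    rw [wordVec_cons, add_sub_right_comm, h2]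
    refine add_mem (heckeOp_mem (b := b) _ (fun x hx => ?_) i (fun u => ?_) u) ?_
    · simpa using mul_mem_orderFrac q_mem_orderFrac hx
    · simpa only [one_mul, neg_one_mul, ← sub_eq_add_neg] using ih' u
    · simpa using mul_mem_orderFrac (recCoeff_mem_orderFrac hl.one_le_posPairing) h1

lemma IsReducedWord.prod_inversions_mul_wordVec_mem {l : List b.support} (hl : IsReducedWord l)
    (u : P.weylGroup) :
    (∏ β ∈ inversions b (wprod l),
      algebraMap (TorusRing X) (TorusField X) (oneSubMon (P.root β))) * wordVec l u ∈
        (algebraMap (TorusRing X) (TorusField X)).range := by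
  simp only [algebraMap_oneSubMon]
  rw [← hl.prod_rootsOf fun β => 1 - mon (P.root β)]
  exact prod_one_sub_mon_mul_wordVec_mem l u

/-- Two reduced words with the same product have the same vector if this holds, up to
normalization, for shorter words. -/
lemma IsReducedWord.wordVec_eq_of_forall {l l' : List b.support} (hl : IsReducedWord l)
    (hl' : IsReducedWord l') (h : wprod l = wprod l')
    (ih : ∀ m m' : List b.support, m.length + 1 = l.length → m'.length + 1 = l.length →
      wprod m = wprod m' → normVec m = normVec m') : wordVec l = wordVec l' := by
  classical
  ext u
  rw [← sub_eq_zero]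
  refine eq_zero_of_mem_orderFrac (ht := posPairing b) ?_ ?_
    (sub_mem (hl.wordVec_mem_orderFrac_neg u) (hl'.wordVec_mem_orderFrac_neg u))
  · have h1 := hl.prod_inversions_mul_wordVec_mem u
    have h2 := hl'.prod_inversions_mul_wordVec_mem u
    rw [← h] at h2
    -- The target set of factors is empty: every possible pole of the difference is shown to cancel.
    have h3 := prod_mul_mem_range_of_mem_regularAlong (K := TorusField X)
      (fun β => oneSubMon (P.root β))
      (inversions b (wprod l)) ∅ (x := wordVec l u - wordVec l' u)
      (fun β _ => oneSubMon_ne_zero (P.ne_zero β)) ?_ (by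
        rw [mul_sub]; exact sub_mem h1 h2)
    · simpa using h3
    · intro γ hγ _
      obtain ⟨m, hm, hmw, hmphi, hmvec⟩ := hl.exists_residue hγ
      have hγ' := hγ
      rw [h] at hγ'
      obtain ⟨m', hm', hmw', hmphi', hmvec'⟩ := hl'.exists_residue hγ'
      have hlen : l.length = l'.length := by
        rw [IsReducedWord] at hl hl'
        rw [hl, hl', h]
      rw [← h] at hmw' hmphi'
      have hnorm := ih m m' hm (hm'.trans hlen.symm) (hmw.trans hmw'.symm)
      set F := ∏ β ∈ (inversions b (wprod l)).erase γ, phi (P.root β) with hF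
      have hF0 : F ≠ 0 := Finset.prod_ne_zero_iff.2 fun β _ => phi_root_ne_zero β
      have hFinv : F⁻¹ ∈ regAlong (P.root γ) := by
        rw [hF, ← Finset.prod_inv_distrib]
        refine prod_mem fun β hβ => inv_phi_mem ?_
        obtain ⟨h4, h5⟩ := Finset.mem_erase.1 hβ
        exact independent_root (mem_inversions.1 h5).1 (mem_inversions.1 hγ).1 h4
      have hcross : wordVec m u * wordPhi m' = wordVec m' u * wordPhi m := by
        rw [wordVec_eq m, wordVec_eq m', hnorm]; ring
      obtain ⟨a, ha, ha'⟩ := hmphi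
      obtain ⟨c, hc, hc'⟩ := hmphi'
      obtain ⟨hmu, d, hd, hd'⟩ := hmvec u
      obtain ⟨hmu', e, he, he'⟩ := hmvec' u
      -- Both normalizing factors are congruent to `F`, which is invertible along `γ`; so equal
      -- normalized vectors give congruent vectors, and the residues coincide.
      have h6 : wordVec m u - wordVec m' u =
          (1 - mon (P.root γ)) * (F⁻¹ * (a * wordVec m' u - c * wordVec m u)) := by
        apply mul_left_cancel₀ hF0
        rw [mul_left_comm, mul_inv_cancel_left₀ hF0]
        linear_combination hcross + wordVec m' u * ha' - wordVec m u * hc'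
      have h7 : wordVec l u - wordVec l' u =
          d - e + (1 - q X) * (F⁻¹ * (a * wordVec m' u - c * wordVec m u)) := by
        apply mul_left_cancel₀ (one_sub_mon_ne_zero (P.ne_zero γ))
        linear_combination hd' - he' + (1 - q X) * h6
      rw [h7]
      exact add_mem (sub_mem hd he) (mul_mem (one_sub_q_mem_regAlong _)
        (mul_mem hFinv (sub_mem (mul_mem ha hmu') (mul_mem hc hmu))))
  · have h1 := sub_mem (hl.wordVec_sub_mem_orderFrac u) (hl'.wordVec_sub_mem_orderFrac u)
    rw [← h] at h1
    simpa using h1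

lemma IsReducedWord.wordPhi_eq {l : List b.support} (hl : IsReducedWord l) :
    wordPhi l = ∏ β ∈ inversions b (wprod l), phi (P.root β) :=
  hl.prod_rootsOf fun β => phi (P.root β)

/-- The normalized vector of a word depends on the product of the word only. -/
theorem normVec_eq_of_wprod_eq {l l' : List b.support} (h : wprod l = wprod l') :
    normVec l = normVec l' := by
  suffices key : ∀ (n : ℕ) (l l' : List b.support), l.length ≤ n → l'.length ≤ n →
      wprod l = wprod l' → normVec l = normVec l' from
    key _ l l' (le_max_left _ _) (le_max_right _ _) h
  clear h l l'
  intro n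
  induction n with
  | zero =>
    intro l l' hl hl' _
    rw [List.length_eq_zero_iff.1 (Nat.le_zero.1 hl), List.length_eq_zero_iff.1 (Nat.le_zero.1 hl')]
  | succ n ih =>
    -- A nonreduced word can be shortened. If its tail is not reduced, induction replaces the tail.
    -- If the tail is reduced, exchange rewrites it to begin with the same letter `i`, and the
    -- double letter cancels. The empty word satisfies the second alternative as it stands.
    have shorten : ∀ l : List b.support, l.length ≤ n + 1 → IsReducedWord l ∨
        ∃ m : List b.support, m.length ≤ n ∧ wprod m = wprod l ∧ normVec m = normVec l := by
      intro l hl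
      rcases l with - | ⟨i, l⟩
      · exact Or.inr ⟨[], by simp, rfl, rfl⟩
      rw [List.length_cons, Nat.add_le_add_iff_right] at hl
      obtain ⟨m, hm, hml⟩ := exists_isReducedWord b (wprod l)
      have hle : m.length ≤ l.length := by
        have := length_wprod_le l
        rw [IsReducedWord] at hm
        rwa [hm, hml]
      rcases hle.lt_or_eq with hlt | heq
      · refine Or.inr ⟨i :: m, by rw [List.length_cons]; omega, by rw [wprod_cons, wprod_cons, hml],
          normVec_cons_congr i hml (ih m l (by omega) hl hml)⟩
      · have hred : IsReducedWord l := by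
          rw [IsReducedWord] at hm ⊢
          rw [← heq, hm, hml]
        by_cases hi : IsReducedWord (i :: l)
        · exact Or.inl hi
        obtain ⟨k, hk, hkl⟩ := exists_of_not_isReducedWord_cons hred hi
        refine Or.inr ⟨k, by omega, ?_, ?_⟩
        · rw [wprod_cons, ← hkl, wprod_cons, refl_mul_refl_mul]
        · rw [← normVec_cons_cons i k]
          exact normVec_cons_congr i hkl (ih _ l (by rw [List.length_cons]; omega) hl hkl)
    intro l l' hl hl' h
    rcases shorten l hl with h1 | ⟨m, hm, hmw, hmv⟩ <;>
      rcases shorten l' hl' with h1' | ⟨m', hm', hmw', hmv'⟩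
    · have : wordVec l = wordVec l' := by
        refine h1.wordVec_eq_of_forall h1' h fun m m' hm hm' hmm => ih m m' ?_ ?_ hmm <;> omega
      ext u
      rw [normVec, normVec, this, h1.wordPhi_eq, h1'.wordPhi_eq, h]
    -- A reduced word is no longer than any word with the same product, so the induction hypothesis
    -- applies to it too.
    · have h2 : l.length ≤ n := by
        have := length_wprod_le m'
        rw [IsReducedWord] at h1
        rw [h1, h, ← hmw']
        omega
      rw [← hmv']
      exact ih l m' h2 hm' (h.trans hmw'.symm)
    · have h2 : l'.length ≤ n := by
        have := length_wprod_le m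
        rw [IsReducedWord] at h1'
        rw [h1', ← h, ← hmw]
        omega
      rw [← hmv]
      exact ih m l' hm h2 (hmw.trans h)
    · rw [← hmv, ← hmv']
      exact ih m m' hm hm' (hmw.trans (h.trans hmw'.symm))

lemma IsReducedWord.wordVec_eq {l l' : List b.support} (hl : IsReducedWord l)
    (hl' : IsReducedWord l') (h : wprod l = wprod l') : wordVec l = wordVec l' := by
  ext u
  rw [BumpNakasuji.wordVec_eq l, BumpNakasuji.wordVec_eq l', normVec_eq_of_wprod_eq h,
    hl.wordPhi_eq, hl'.wordPhi_eq, h]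

lemma IsReducedWord.bruhatLE_of_wordVec_ne_zero {l : List b.support} (hl : IsReducedWord l)
    {u : P.weylGroup} (hu : wordVec l u ≠ 0) : BruhatLE b u (wprod l) := by
  induction l generalizing u with
  | nil =>
    rw [wordVec] at hu
    have : u = 1 := by
      by_contra h
      exact hu (if_neg h)
    rw [this]
    exact Relation.ReflTransGen.refl
  | cons i l ih =>
    have h1 : BruhatLE b (wprod l) (wprod (i :: l)) := by
      rw [wprod_cons]
      exact bruhatLE_refl_mul i.2 hl.isPos
    by_cases h2 : wordVec l u = 0
    · have h3 : wordVec l (refl P i * u) ≠ 0 := by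
        intro h3
        rw [wordVec_cons, h2] at hu
        by_cases h : b.IsPos (u⁻¹ • (i : ι))
        · rw [heckeOp_of_isPos h, h3] at hu
          simp at hu
        · rw [heckeOp_of_not_isPos h, h2, h3] at hu
          simp at hu
      rw [wprod_cons]
      exact bruhatLE_of_refl_mul_le i.2 (ih hl.tail h3) hl.isPos
    · exact (ih hl.tail h2).trans h1

/-- The extension to nonreduced words is needed for the words that arise as residues; it follows
because vectors of words with equal products are proportional. -/
lemma bruhatLE_of_wordVec_ne_zero {l : List b.support} {u : P.weylGroup} (hu : wordVec l u ≠ 0) :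
    BruhatLE b u (wprod l) := by
  obtain ⟨m, hm, hml⟩ := exists_isReducedWord b (wprod l)
  rw [← hml]
  refine hm.bruhatLE_of_wordVec_ne_zero fun h => hu ?_
  rw [wordVec_eq, normVec_eq_of_wprod_eq hml.symm, normVec, h, zero_div, mul_zero]

lemma IsReducedWord.wordVec_wprod {l : List b.support} (hl : IsReducedWord l) :
    wordVec l (wprod l) = 1 := by
  induction l with
  | nil => rw [wordVec, wprod_nil, if_pos rfl]
  | cons i l ih =>
    have h1 : wordVec l (wprod (i :: l)) = 0 := by
      by_contra h
      have h1 := (hl.tail.bruhatLE_of_wordVec_ne_zero h).length_le.1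
      have h2 := hl.tail
      rw [IsReducedWord] at h2 hl
      rw [List.length_cons] at hl
      omega
    have h2 : ¬ b.IsPos ((wprod (i :: l))⁻¹ • (i : ι)) := by
      rw [wprod_cons, isPos_refl_mul_inv_smul, not_not]
      exact hl.isPos
    rw [wordVec_cons, heckeOp_of_not_isPos h2, h1, wprod_cons, refl_mul_refl_mul, ih hl.tail]
    ring

/-- The deformed `R`-polynomials, computed from a reduced word. -/
def rPoly (b : P.Base) (u v : P.weylGroup) : TorusField X :=
  wordVec (exists_isReducedWord b v).choose u

lemma IsReducedWord.rPoly_eq {l : List b.support} (hl : IsReducedWord l) (u : P.weylGroup) :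
    rPoly b u (wprod l) = wordVec l u := by
  obtain ⟨h1, h2⟩ := (exists_isReducedWord b (wprod l)).choose_spec
  exact congrFun (h1.wordVec_eq hl h2) u

lemma rPoly_eq_of_bruhatLT {i : ι} (hi : i ∈ b.support) {v : P.weylGroup}
    (h : BruhatLT b (refl P i * v) v) (u : P.weylGroup) :
    rPoly b u v = heckeOp b i (fun u => rPoly b u (refl P i * v)) u +
      recCoeff (-(v⁻¹ • P.root i)) * rPoly b u (refl P i * v) := by
  obtain ⟨l, hl, hlv⟩ := exists_isReducedWord b (refl P i * v)
  have h1 : IsReducedWord (⟨i, hi⟩ :: l) := hl.cons (by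
    rw [hlv, isPos_refl_mul_inv_smul]
    exact (bruhatLT_refl_mul_iff hi v).1 h)
  have h2 : wprod (⟨i, hi⟩ :: l) = v := by rw [wprod_cons, hlv, refl_mul_refl_mul]
  have h3 : P.root ((wprod l)⁻¹ • i) = -(v⁻¹ • P.root i) := by
    rw [hlv, mul_inv_rev, refl_inv, mul_smul, root_smul_refl_smul_self, root_smul]
  have h4 := h1.rPoly_eq u
  rw [h2, wordVec_cons, h3] at h4
  simp only [← hlv, hl.rPoly_eq]
  exact h4

theorem isRFamily_rPoly (b : P.Base) : IsRFamily b (rPoly b) where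
  eq_zero u v h := by
    obtain ⟨l, hl, rfl⟩ := exists_isReducedWord b v
    rw [hl.rPoly_eq]
    by_contra h1
    exact h (bruhatLE_of_wordVec_ne_zero h1)
  eq_one v := by
    obtain ⟨l, hl, rfl⟩ := exists_isReducedWord b v
    rw [hl.rPoly_eq, hl.wordVec_wprod]
  rec_descent i hi u v β hv hβ hu := by
    have h0 : β ≠ 0 := by
      rw [hβ, ← root_smul, neg_ne_zero]
      exact P.ne_zero _
    have := one_sub_mon_ne_zero h0
    -- The coefficient is matched by `(1 - q)/(1 - y^β) = (1 - q) + c(β)`.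
    rw [rPoly_eq_of_bruhatLT hi hv, heckeOp_of_not_isPos ((bruhatLT_refl_mul_iff hi u).1 hu), ← hβ,
      recCoeff]
    field_simp
    ring
  rec_ascent i hi u v β hv hβ hu := by
    rw [rPoly_eq_of_bruhatLT hi hv, heckeOp_of_isPos ((bruhatLT_refl_mul_iff' hi u).1 hu), ← hβ,
      recCoeff]
    ring

theorem IsRFamily.eq {r r' : P.weylGroup → P.weylGroup → TorusField X} (hr : IsRFamily b r)
    (hr' : IsRFamily b r') : r = r' := by
  suffices h : ∀ (l : List b.support), IsReducedWord l → ∀ u, r u (wprod l) = r' u (wprod l) by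
    ext u v
    obtain ⟨l, hl, rfl⟩ := exists_isReducedWord b v
    exact h l hl u
  intro l hl
  induction l with
  | nil =>
    intro u
    by_cases hu : u = 1
    · rw [hu, wprod_nil, hr.eq_one, hr'.eq_one]
    · have h1 : ¬ BruhatLE b u (wprod ([] : List b.support)) := fun h => hu (eq_one_of_length_eq_zero (b := b) (by
        have := h.length_le.1
        rw [wprod_nil, length_one] at this
        omega))
      rw [hr.eq_zero _ _ h1, hr'.eq_zero _ _ h1]
  | cons i l ih =>
    intro u
    have h1 : refl P i * wprod (i :: l) = wprod l := by rw [wprod_cons, refl_mul_refl_mul]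
    have h2 : BruhatLT b (refl P i * wprod (i :: l)) (wprod (i :: l)) := by
      rw [bruhatLT_refl_mul_iff i.2, wprod_cons, isPos_refl_mul_inv_smul, not_not]
      exact hl.isPos
    by_cases hu : b.IsPos (u⁻¹ • (i : ι))
    · have h3 := (bruhatLT_refl_mul_iff' i.2 u).2 hu
      rw [hr.rec_ascent i i.2 u _ _ h2 rfl h3, hr'.rec_ascent i i.2 u _ _ h2 rfl h3, h1,
        ih hl.tail, ih hl.tail]
    · have h3 := (bruhatLT_refl_mul_iff i.2 u).2 hu
      rw [hr.rec_descent i i.2 u _ _ h2 rfl h3, hr'.rec_descent i i.2 u _ _ h2 rfl h3, h1,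
        ih hl.tail, ih hl.tail]

theorem prod_denomRoots_mul_rPoly_mem (u v : P.weylGroup) :
    (∏ β ∈ denomRoots b u v, (1 - mon (P.root β))) * rPoly b u v ∈
      (algebraMap (TorusRing X) (TorusField X)).range := by
  obtain ⟨l, hl, rfl⟩ := exists_isReducedWord b v
  rw [hl.rPoly_eq]
  have := prod_mul_mem_range_of_mem_regularAlong (K := TorusField X)
    (fun β => oneSubMon (P.root β)) (inversions b (wprod l)) (denomRoots b u (wprod l))
    (fun β _ => oneSubMon_ne_zero (P.ne_zero β)) ?_ (hl.prod_inversions_mul_wordVec_mem u)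
  · simpa only [algebraMap_oneSubMon] using this
  · intro γ hγ hγu
    obtain ⟨m, -, hmw, -, hm⟩ := hl.exists_residue hγ
    obtain ⟨-, h, hh, hh'⟩ := hm u
    -- The residue along `γ` is a multiple of this coefficient, and `m` has product `v r_γ`. A
    -- nonzero value would give `u ≤ v r_γ < v` and put `γ` in `S(u,v)`.
    have h0 : wordVec m u = 0 := by
      by_contra h1
      have h2 := bruhatLE_of_wordVec_ne_zero h1
      rw [hmw] at h2
      obtain ⟨h3, h4⟩ := mem_inversions.1 hγ
      refine hγu ?_
      simp only [denomRoots, Finset.mem_filter]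
      exact ⟨Finset.mem_univ γ, h3, h2, bruhatLT_mul_refl (length_mul_refl_lt h3 h4)⟩
    rw [h0, mul_zero, sub_zero] at hh'
    rw [mul_left_cancel₀ (one_sub_mon_ne_zero (P.ne_zero γ)) hh']
    exact hh

end Canonical

end BumpNakasuji

end
theorem theorem7p3 {ι X Y : Type*} [Fintype ι] [AddCommGroup X] [AddCommGroup Y]
    [Module.Free ℤ X] [Module.Finite ℤ X]
    (P : RootDatum ι X Y) [P.IsReduced] (b : P.Base) :
    (∃! r : P.weylGroup → P.weylGroup → BumpNakasuji.TorusField X, BumpNakasuji.IsRFamily b r) ∧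
    ∀ r : P.weylGroup → P.weylGroup → BumpNakasuji.TorusField X, BumpNakasuji.IsRFamily b r →
      ∀ u v : P.weylGroup, ∃ f : BumpNakasuji.TorusRing X,
        algebraMap (BumpNakasuji.TorusRing X) (BumpNakasuji.TorusField X) f =
          (∏ β ∈ BumpNakasuji.denomRoots b u v, (1 - BumpNakasuji.mon (P.root β))) * r u v := by
  refine ⟨⟨BumpNakasuji.rPoly b, BumpNakasuji.isRFamily_rPoly b,
    fun r hr => hr.eq (BumpNakasuji.isRFamily_rPoly b)⟩, fun r hr u v => ?_⟩
  rw [hr.eq (BumpNakasuji.isRFamily_rPoly b)]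
  exact BumpNakasuji.prod_denomRoots_mul_rPoly_mem u v
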